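/- Let $P_Z$ be a probability distribution on a measurable space $\mathcal Z$, let $d,N,T$ be natural numbers with $N\ge 1$, and let $\ell:\mathbb R^d\times\mathcal Z\to[a,b]$ be a measurable loss which is differentiable in its first argument. (A hypothesis $W_\theta$ is identified with its parameter $\theta\in\mathbb R^d$.) *Randomized subsample setting.* Let $\tilde S=(\tilde Z_1,\dots,\tilde Z_{2N})$ be i.i.d. from $P_Z$, let $U=(U_1,\dots,U_N)$ be i.i.d. Bernoulli$(1/2)$ variables, and let $S=(Z_1,\dots,Z_N)$ with $Z_i=\tilde Z_{i+U_iN}$. Write $L_{S_B}(\theta)=\frac1{|B|}\sum_{i\in B}\ell(\theta,Z_i)$ for $B\subseteq[N]$ and $\mathrm{gen}(\theta,S)=\mathbb E_{Z\sim P_Z}[\ell(\theta,Z)]-L_S(\theta)$. *SGLD.* Let $V^T=(V_1,\dots,V_T)$ be a random sequence of batches $V_t\subseteq[N]$ (with an arbitrary joint law), $\theta_0$ a random initialization in $\mathbb R^d$ (with an arbitrary law), and $\varepsilon_1,\dots,\varepsilon_T$ i.i.d. $\mathcal N(0,I_d)$ vectors, where $\tilde S$, $U$, $V^T$, $\theta_0$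 and $(\varepsilon_t)_t$ are independent. Let $\eta_t\in\mathbb R$ and $\sigma_t>0$ be constants and put $$\theta_t=\theta_{t-1}-\eta_t\nabla L_{S_{V_t}}(\theta_{t-1})+\sigma_t\varepsilon_t,\qquad t=1,\dots,T,$$ with no gradient step if $V_t=\emptyset$. The output is $W=\theta_T$; write $W^{t-1}=(\theta_0,\dots,\theta_{t-1})$ and $V^{t-1}=(V_1,\dots,V_{t-1})$. Let $J$ be uniformly distributed on $[N]$ and independent of $(\tilde S,U,V^T)$, and write $U_{J^c}=(U_i)_{i\ne J}$. For each $t$ let $\pi_{J,t}\in[0,1]$ be any estimate of the probability that $U_J=1$ that is a measurable function of $(J,W^{t-1},\tilde S,U_{J^c},V^T)$. Put $$\zeta_{J,t}=\nabla_\theta\ell(\theta_{t-1},\tilde Z_J)-\nabla_\theta\ell(\theta_{t-1},\tilde Z_{J+N}),\qquad \mathcal T_J(V^T)=\{t\in[T]:J\in V_t\}.$$ Then $$\mathbb E[\mathrm{gen}(W,S)]\le\sqrt2\,(b-a)\;\mathbb E_{P_1}\!\left[\sqrt{\sum_{t\in\mathcal T_J(V^T)}\mathbb E_{P_2^t}\!\left[\frac{\eta_t^2\|\zeta_{J,t}\|^2}{2\sigma_t^2|V_t|^2}\,(U_J-\pi_{J,t})^2\right]}\right],$$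 where $P_1=P_{J,\tilde S,U,V^T}$ is the joint law of $(J,\tilde S,U,V^T)$ and $P_2^t=P_{W^{t-1}\mid U,\tilde S,V^{t-1}}$ is the conditional law of $W^{t-1}$ given $(U,\tilde S,V^{t-1})$. The expectations on the right-hand side are those of non-negative quantities and may be infinite (with $0\cdot\infty=0$). -/

import Mathlib

open MeasureTheory ProbabilityTheory
open scoped ENNReal

namespace SGLDGen

/-- The parameter space `ℝᵈ` with its Euclidean norm. A hypothesis `W_θ` is completely characterized
by its parameter `θ`, and is identified with it. -/
abbrev Param (d : ℕ) : Type := EuclideanSpace ℝ (Fin d)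

/-- The index `i + u N` in a super-sample of size `2N`: the index `i` of the first half for `u = 0`,
the index `i + N` of the second half for `u = 1`. -/
def superIndex {N : ℕ} (i : Fin N) (u : Bool) : Fin (N + N) :=
  if u then Fin.natAdd N i else Fin.castAdd N i

/-- The dataset `S = (Z₁, …, Z_N)`, `Z_i = Z̃_{i + U_i N}`, chosen from the super-sample by `U`. -/
def dataset {Z : Type*} {N : ℕ} (s : Fin (N + N) → Z) (u : Fin N → Bool) : Fin N → Z :=
  fun i => s (superIndex i (u i))

/-- The empirical risk on the samples with indices in `B`: the average of the losses over `B`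
(zero if `B` is empty). -/
noncomputable def batchRisk {Z : Type*} {d N : ℕ} (loss : Param d → Z → ℝ) (z : Fin N → Z)
    (B : Finset (Fin N)) (θ : Param d) : ℝ :=
  (1 / (B.card : ℝ)) * ∑ i ∈ B, loss θ (z i)

/-- The generalization error: population risk minus empirical risk on the whole dataset. -/
noncomputable def gen {Z : Type*} [MeasurableSpace Z] {d N : ℕ} (P : Measure Z)
    (loss : Param d → Z → ℝ) (θ : Param d) (z : Fin N → Z) : ℝ :=
  (∫ x, loss θ x ∂P) - batchRisk loss z Finset.univ θ

/-- The SGLD iterates `θ_0, …, θ_T`. The step number `t : Fin T` (counted from zero) leads from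
`θ_t` to `θ_{t+1} = θ_t - η_t ∇L_{S_{V_t}}(θ_t) + σ_t ε_t`. -/
noncomputable def sgld {Z : Type*} {d N T : ℕ} (loss : Param d → Z → ℝ) (η σ : Fin T → ℝ)
    (z : Fin N → Z) (v : Fin T → Finset (Fin N)) (θ₀ : Param d) (ε : Fin T → Param d) :
    Fin (T + 1) → Param d :=
  Fin.induction θ₀ fun t θ =>
    θ - η t • gradient (fun θ' => batchRisk loss z (v t) θ') θ + σ t • ε t

/-- The part `θ_0, …, θ_t` of a trajectory that is known before step `t` is carried out. -/
def pastIterates {E : Type*} {T : ℕ} (θ : Fin (T + 1) → E) (t : Fin T) : Fin (t.val + 1) → E :=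
  fun k => θ (k.castLE (Nat.succ_le_succ t.isLt.le))

/-- The batches of the steps strictly before step `t`. -/
def pastBatches {B : Type*} {T : ℕ} (v : Fin T → B) (t : Fin T) : Fin t.val → B :=
  fun k => v (k.castLE t.isLt.le)

/-- The two-sample gradient incoherence at `θ` for the pair of samples `j` and `j + N`. -/
noncomputable def incoherence {Z : Type*} {d N : ℕ} (loss : Param d → Z → ℝ)
    (s : Fin (N + N) → Z) (j : Fin N) (θ : Param d) : Param d :=
  gradient (fun θ' => loss θ' (s (superIndex j false))) θ
    - gradient (fun θ' => loss θ' (s (superIndex j true))) θ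

/-- A Boolean as the number `0` or `1`. -/
def bit (u : Bool) : ℝ := if u then 1 else 0

/-- The summand of step `t`,
`η_t² ‖ζ_{j,t}‖² / (2 σ_t² |V_t|²) * (U_j - p)²`, at the parameter `θ` from which the step starts,
with `p` the value of the estimate of the probability that `U_j = 1`. -/
noncomputable def summand {Z : Type*} {d N T : ℕ} (loss : Param d → Z → ℝ) (η σ : Fin T → ℝ)
    (s : Fin (N + N) → Z) (u : Fin N → Bool) (v : Fin T → Finset (Fin N)) (j : Fin N) (t : Fin T)
    (θ : Param d) (p : ℝ) : ℝ :=
  (η t ^ 2 * ‖incoherence loss s j θ‖ ^ 2) / (2 * σ t ^ 2 * ((v t).card : ℝ) ^ 2)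
    * (bit (u j) - p) ^ 2

/-- The steps whose batch contains the sample `j`. -/
def stepsWith {N T : ℕ} (v : Fin T → Finset (Fin N)) (j : Fin N) : Finset (Fin T) :=
  Finset.univ.filter fun t => j ∈ v t

end SGLDGen

/-! In each pair `j` the discarded member of the super-sample is independent of the output, so the
mean generalization error is the average over `j` of the mean gap between the losses at the
discarded and at the selected sample (`integral_gen_eq`). At a fixed parameter this gap is odd under
reversal of `U_j` (`ghostGap_flip`).

Compare SGLD with a reference process in which the gradient of the sample `j` is replaced by the
mixture of the two candidate gradients with weights `1 - π` and `π`. The reference process does not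
see `U_j`, so its mean gap changes sign when `U_j` is reversed. Adding both selections cancels the
reference values and leaves only the two deviations from them (`meanGap_add_flip_le`); as reversal
preserves the law of the configuration, averaging bounds the mean gap by a mean deviation
(`ofReal_integral_meanGap_le`).

For a fixed configuration the deviation is controlled by Pinsker's inequality for a function bounded
by `b - a` (`EntropyLE.integral_sub_le`). By the chain rule the relative entropy of the trajectories
is at most the sum of the mean Gaussian step entropies, squared drift difference over `2σ²`
(`entropyLE_trajLaw`), and these are exactly the summands of the claim (`norm_stepMean_sub_sq`).
Entropy enters only through the Donsker–Varadhan inequality, for which the chain rule is a short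
induction. The conditional laws in the claim are identified by `condDistrib_pastIterates`. -/

namespace SGLDGen

/-! ### Relative entropy in dual form and Pinsker's inequality. -/

section Entropy

/-- The Donsker–Varadhan form of the assertion that the relative entropy of `P` with respect to `Q`
is at most `D`. -/
def EntropyLE {α : Type*} [MeasurableSpace α] (P Q : Measure α) (D : ℝ) : Prop :=
  ∀ g : α → ℝ, Measurable g → (∃ C, ∀ x, |g x| ≤ C) →
    ∫ x, g x ∂P ≤ D + Real.log (∫ x, Real.exp (g x) ∂Q)

variable {α β : Type*} [MeasurableSpace α] [MeasurableSpace β]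

lemma integrable_of_abs_le {P : Measure α} [IsFiniteMeasure P] {g : α → ℝ} (hg : Measurable g)
    {C : ℝ} (hC : ∀ x, |g x| ≤ C) : Integrable g P :=
  Integrable.of_bound hg.aestronglyMeasurable C (ae_of_all _ hC)

lemma integrable_exp_of_abs_le {P : Measure α} [IsFiniteMeasure P] {g : α → ℝ}
    (hg : Measurable g) {C : ℝ} (hC : ∀ x, |g x| ≤ C) :
    Integrable (fun x => Real.exp (g x)) P :=
  integrable_of_abs_le (C := Real.exp C) hg.exp fun x => by
    rw [abs_of_pos (Real.exp_pos _)]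
    exact Real.exp_le_exp.2 ((le_abs_self _).trans (hC x))

lemma abs_log_integral_exp_le {P : Measure α} [IsProbabilityMeasure P] {g : α → ℝ}
    (hg : Measurable g) {C : ℝ} (hC : ∀ x, |g x| ≤ C) :
    |Real.log (∫ x, Real.exp (g x) ∂P)| ≤ C := by
  have hi := integrable_exp_of_abs_le (P := P) hg hC
  have h1 : Real.exp (-C) ≤ ∫ x, Real.exp (g x) ∂P := by
    have := integral_mono (μ := P) (integrable_const (Real.exp (-C))) hi
      fun x => Real.exp_le_exp.2 (neg_le_of_abs_le (hC x))
    simpa using this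
  have h2 : ∫ x, Real.exp (g x) ∂P ≤ Real.exp C := by
    have := integral_mono (μ := P) hi (integrable_const (Real.exp C))
      fun x => Real.exp_le_exp.2 (le_of_abs_le (hC x))
    simpa using this
  have hpos : 0 < ∫ x, Real.exp (g x) ∂P := (Real.exp_pos _).trans_le h1
  rw [abs_le]
  exact ⟨(Real.le_log_iff_exp_le hpos).2 h1, (Real.log_le_iff_le_exp hpos).2 h2⟩

/-- Jensen's inequality for `exp`. It starts the induction in the chain rule, where both processes
have the same initial law. -/
lemma EntropyLE.refl (P : Measure α) [IsProbabilityMeasure P] : EntropyLE P P 0 := by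
  rintro g hg ⟨C, hC⟩
  have h := (convexOn_exp).map_integral_le (μ := P) (f := g) Real.continuous_exp.continuousOn
    isClosed_univ (by simp) (integrable_of_abs_le hg hC) (integrable_exp_of_abs_le hg hC)
  rw [zero_add, Real.le_log_iff_exp_le ((Real.exp_pos _).trans_le h)]
  exact h

/-- Pinsker's inequality in dual form. -/
lemma EntropyLE.integral_sub_le {P Q : Measure α} [IsProbabilityMeasure P] [IsProbabilityMeasure Q]
    {D : ℝ} (hD : 0 ≤ D) (h : EntropyLE P Q D) {f : α → ℝ} (hf : Measurable f) {c : ℝ}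
    (hc : ∀ x, |f x| ≤ c) :
    ∫ x, f x ∂P - ∫ x, f x ∂Q ≤ √2 * c * √D := by
  obtain ⟨x₀⟩ : Nonempty α := nonempty_of_isProbabilityMeasure P
  have hc0 : 0 ≤ c := (abs_nonneg _).trans (hc x₀)
  -- Test the entropy bound with `l (f - E_Q f)`; Hoeffding's lemma on the interval `[-c, c]` bounds
  -- the log-Laplace transform by `c² l² / 2`.
  have key : ∀ l : ℝ, 0 < l → ∫ x, f x ∂P - ∫ x, f x ∂Q ≤ D / l + l * c ^ 2 / 2 := by
    intro l hl
    have hsub := hasSubgaussianMGF_of_mem_Icc (μ := Q) (X := f) (a := -c) (b := c) hf.aemeasurable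
      (ae_of_all _ fun x => abs_le.1 (hc x))
    have h1 := hsub.mgf_le l
    have h2 := h (fun x => l * (f x - ∫ y, f y ∂Q)) (by fun_prop)
      ⟨l * (c + |∫ y, f y ∂Q|), fun x => by
        rw [abs_mul, abs_of_pos hl]
        gcongr
        exact (abs_sub _ _).trans (by gcongr; exact hc x)⟩
    have hpos : 0 < ∫ x, Real.exp (l * (f x - ∫ y, f y ∂Q)) ∂Q :=
      integral_exp_pos (hsub.integrable_exp_mul l)
    have h3 : Real.log (∫ x, Real.exp (l * (f x - ∫ y, f y ∂Q)) ∂Q) ≤ c ^ 2 * l ^ 2 / 2 := by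
      rw [Real.log_le_iff_le_exp hpos]
      refine h1.trans (le_of_eq ?_)
      congr 3
      simp only [NNReal.coe_pow, NNReal.coe_div, coe_nnnorm, NNReal.coe_ofNat, Real.norm_eq_abs]
      rw [div_pow, sq_abs]; ring
    rw [integral_const_mul, integral_sub (integrable_of_abs_le hf hc) (integrable_const _)] at h2
    simp only [integral_const, probReal_univ, smul_eq_mul, one_mul] at h2
    have h4 : l * (∫ x, f x ∂P - ∫ x, f x ∂Q) ≤ D + c ^ 2 * l ^ 2 / 2 := h2.trans (by gcongr)
    have h5 : ∫ x, f x ∂P - ∫ x, f x ∂Q ≤ (D + c ^ 2 * l ^ 2 / 2) / l := by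
      rw [le_div_iff₀ hl]; linarith
    refine h5.trans (le_of_eq ?_)
    field_simp
  rcases hc0.eq_or_lt with rfl | hcpos
  · have : f = 0 := by ext x; simpa using hc x
    simp [this]
  rcases hD.eq_or_lt with rfl | hDpos
  -- For `D = 0` the optimal `l` degenerates to zero; this choice makes the remaining term equal to
  -- `e`.
  · refine le_of_forall_pos_le_add fun e he => ?_
    have := key (2 * e / c ^ 2) (by positivity)
    refine this.trans (le_of_eq ?_)
    simp; field_simp
  · have hs : 0 < √D := Real.sqrt_pos.2 hDpos
    -- The minimizer of `D / l + l c² / 2`, at which both terms are equal.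
    have := key (√2 * √D / c) (by positivity)
    refine this.trans (le_of_eq ?_)
    have e1 : √D ^ 2 = D := Real.sq_sqrt hD
    have e2 : √(2:ℝ) ^ 2 = 2 := Real.sq_sqrt (by norm_num)
    have e3 : D / (√2 * √D / c) = √2 * √D * c / 2 := by
      rw [div_eq_iff (by positivity)]
      field_simp
      rw [e1, e2, mul_comm]
    rw [e3]
    field_simp
    ring

end Entropy

/-! ### Relative entropy of shifted Gaussian vectors. -/

section Gaussian

lemma gaussianReal_eq_withDensity_zero (c : ℝ) :
    gaussianReal c 1 = (gaussianReal 0 1).withDensity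
      fun x => ENNReal.ofReal (Real.exp (c * x - c ^ 2 / 2)) := by
  rw [gaussianReal_of_var_ne_zero _ one_ne_zero, gaussianReal_of_var_ne_zero _ one_ne_zero,
    ← withDensity_mul _ (measurable_gaussianPDF _ _) (by fun_prop)]
  congr 1
  ext x
  simp only [Pi.mul_apply, gaussianPDF]
  rw [← ENNReal.ofReal_mul (gaussianPDFReal_nonneg _ _ _)]
  congr 1
  simp only [gaussianPDFReal, mul_assoc, ← Real.exp_add]
  congr 2
  simp
  ring

lemma pi_gaussianReal_eq_withDensity {ι : Type*} [Fintype ι] (c : ι → ℝ) :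
    Measure.pi (fun i => gaussianReal (c i) 1) =
      (Measure.pi fun _ : ι => gaussianReal 0 1).withDensity
        fun x => ENNReal.ofReal (Real.exp (∑ i, (c i * x i - c i ^ 2 / 2))) := by
  classical
  refine Measure.pi_eq fun s hs => ?_
  -- The masses of boxes are written as Bochner integrals so that `integral_fintype_prod_eq_prod`
  -- can factor them.
  have hint : ∀ i, Integrable (fun x => (s i).indicator
      (fun x => Real.exp (c i * x - c i ^ 2 / 2)) x) (gaussianReal 0 1) := by
    intro i
    refine Integrable.indicator ?_ (hs i)
    simp only [Real.exp_sub]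
    exact (integrable_exp_mul_gaussianReal (c i)).div_const _
  have hnn : ∀ i x, 0 ≤ (s i).indicator (fun x => Real.exp (c i * x - c i ^ 2 / 2)) x :=
    fun i x => Set.indicator_nonneg (fun _ _ => (Real.exp_pos _).le) x
  have hone : ∀ i, gaussianReal (c i) 1 (s i) = ENNReal.ofReal (∫ x, (s i).indicator
      (fun x => Real.exp (c i * x - c i ^ 2 / 2)) x ∂(gaussianReal 0 1)) := by
    intro i
    rw [ofReal_integral_eq_lintegral_ofReal (hint i) (ae_of_all _ (hnn i)),
      gaussianReal_eq_withDensity_zero, withDensity_apply _ (hs i), ← lintegral_indicator (hs i)]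
    congr 1; ext x
    by_cases hx : x ∈ s i <;> simp [hx]
  have hprod : Integrable (fun x : ι → ℝ => ∏ i, (s i).indicator
      (fun x => Real.exp (c i * x - c i ^ 2 / 2)) (x i))
      (Measure.pi fun _ : ι => gaussianReal 0 1) := Integrable.fintype_prod hint
  have hbox : MeasurableSet (Set.univ.pi s) := MeasurableSet.univ_pi hs
  rw [withDensity_apply _ hbox, ← lintegral_indicator hbox]
  simp_rw [hone]
  rw [← ENNReal.ofReal_prod_of_nonneg fun i _ => integral_nonneg (hnn i),
    ← integral_fintype_prod_eq_prod (μ := fun _ : ι => gaussianReal 0 1),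
    ofReal_integral_eq_lintegral_ofReal hprod
      (ae_of_all _ fun x => Finset.prod_nonneg fun i _ => hnn i _)]
  congr 1; ext x
  by_cases hx : x ∈ Set.univ.pi s
  · rw [Set.indicator_of_mem hx, Real.exp_sum]
    congr 1
    exact Finset.prod_congr rfl fun i _ => by rw [Set.indicator_of_mem (hx i trivial)]
  · rw [Set.indicator_of_notMem hx]
    obtain ⟨i, hi⟩ : ∃ i, x i ∉ s i := by simpa [Set.mem_pi] using hx
    rw [Finset.prod_eq_zero (Finset.mem_univ i) (Set.indicator_of_notMem hi _)]
    simp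

/-- With `P = e^φ Q`, Jensen under `P` applied to `g - φ` gives `exp (E_P g - E_P φ) ≤ E_P e^(g - φ)
= E_Q e^g`, and `E_P φ = ∑ c_i² / 2`. -/
lemma entropyLE_pi_gaussianReal {ι : Type*} [Fintype ι] (c : ι → ℝ) :
    EntropyLE (Measure.pi fun i => gaussianReal (c i) 1)
      (Measure.pi fun _ : ι => gaussianReal 0 1) ((∑ i, c i ^ 2) / 2) := by
  rintro g hg ⟨C, hC⟩
  set P := Measure.pi fun i => gaussianReal (c i) 1 with hP
  set Q := Measure.pi fun _ : ι => gaussianReal 0 1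
  set φ : (ι → ℝ) → ℝ := fun x => ∑ i, (c i * x i - c i ^ 2 / 2) with hφ
  have hφm : Measurable φ := by fun_prop
  have hdens : P = Q.withDensity fun x => ENNReal.ofReal (Real.exp (φ x)) :=
    pi_gaussianReal_eq_withDensity c
  have hid : ∀ i, Integrable (fun x : ι → ℝ => x i) P := fun i =>
    integrable_comp_eval (μ := fun i => gaussianReal (c i) 1) (f := fun x => x)
      (IsGaussian.integrable_id)
  have hci : ∀ i, Integrable (fun x : ι → ℝ => c i * x i - c i ^ 2 / 2) P := fun i =>
    ((hid i).const_mul _).sub (integrable_const _)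
  have hφi : Integrable φ P := integrable_finsetSum _ fun i _ => hci i
  have hφint : ∫ x, φ x ∂P = (∑ i, c i ^ 2) / 2 := by
    rw [hφ, integral_finsetSum _ fun i _ => hci i, Finset.sum_div]
    refine Finset.sum_congr rfl fun i _ => ?_
    rw [integral_sub ((hid i).const_mul _) (integrable_const _), integral_const_mul]
    have : ∫ x : ι → ℝ, x i ∂P = c i := by
      rw [hP, integral_comp_eval (μ := fun i => gaussianReal (c i) 1) (f := fun x : ℝ => x)
        (by fun_prop), integral_id_gaussianReal]
    rw [this]; simp; ring
  have hgi : Integrable g P := integrable_of_abs_le hg hC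
  have hmul : ∀ x, (Real.exp (φ x)) * Real.exp (g x - φ x) = Real.exp (g x) := fun x => by
    rw [← Real.exp_add]; ring_nf
  have hexpi : Integrable (fun x => Real.exp (g x - φ x)) P := by
    rw [hdens, integrable_withDensity_iff_integrable_smul₀' (by fun_prop) (by simp)]
    simp only [ENNReal.toReal_ofReal (Real.exp_pos _).le, smul_eq_mul, hmul]
    exact integrable_exp_of_abs_le hg hC
  have hexp : ∫ x, Real.exp (g x - φ x) ∂P = ∫ x, Real.exp (g x) ∂Q := by
    rw [hdens, integral_withDensity_eq_integral_toReal_smul (by fun_prop) (by simp)]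
    simp only [ENNReal.toReal_ofReal (Real.exp_pos _).le, smul_eq_mul, hmul]
  have h := (convexOn_exp).map_integral_le (μ := P) (f := fun x => g x - φ x)
    Real.continuous_exp.continuousOn isClosed_univ (by simp) (hgi.sub hφi) hexpi
  rw [hexp, ← Real.le_log_iff_exp_le ((Real.exp_pos _).trans_le h), integral_sub hgi hφi,
    hφint] at h
  linarith

variable {d : ℕ}

lemma integral_add_stdGaussian_le (c : Param d) {g : Param d → ℝ} (hg : Measurable g)
    {C : ℝ} (hC : ∀ x, |g x| ≤ C) :
    ∫ x, g (c + x) ∂(stdGaussian (Param d)) ≤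
      ‖c‖ ^ 2 / 2 + Real.log (∫ x, Real.exp (g x) ∂(stdGaussian (Param d))) := by
  have h := entropyLE_pi_gaussianReal (fun i => c i) (fun x => g (WithLp.toLp 2 x))
    (by fun_prop) ⟨C, fun x => hC _⟩
  have hm : Measurable fun (x : Fin d → ℝ) i => c i + x i :=
    measurable_pi_lambda _ fun i => (measurable_pi_apply i).const_add _
  have hshift : Measure.pi (fun i => gaussianReal (c i) 1) =
      (Measure.pi fun _ : Fin d => gaussianReal 0 1).map fun x i => c i + x i := by
    rw [Measure.pi_map_pi (f := fun i x => c i + x)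
      (fun i => (measurable_id.const_add (c i)).aemeasurable)]
    congr 1; ext1 i
    rw [gaussianReal_map_const_add]; simp
  have hto : Measurable (WithLp.toLp 2 : (Fin d → ℝ) → Param d) := by fun_prop
  have hgto : Measurable fun x : Fin d → ℝ => g (WithLp.toLp 2 x) := hg.comp hto
  have hgc : Measurable fun x => g (c + x) := hg.comp (measurable_id.const_add c)
  rw [hshift, integral_map hm.aemeasurable hgto.aestronglyMeasurable] at h
  rw [← map_pi_eq_stdGaussian, integral_map hto.aemeasurable hgc.aestronglyMeasurable,
    integral_map hto.aemeasurable hg.exp.aestronglyMeasurable, EuclideanSpace.norm_sq_eq]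
  simpa using! h

/-- In units of the noise level the two means differ by `(a - a') / s`, so this is the unit-variance
bound for the test function `g (a' + s •)`. -/
lemma integral_gaussian_step_le (a a' : Param d) {s : ℝ} (hs : 0 < s) {g : Param d → ℝ}
    (hg : Measurable g) {C : ℝ} (hC : ∀ x, |g x| ≤ C) :
    ∫ x, g (a + s • x) ∂(stdGaussian (Param d)) ≤
      ‖a - a'‖ ^ 2 / (2 * s ^ 2) +
        Real.log (∫ x, Real.exp (g (a' + s • x)) ∂(stdGaussian (Param d))) := by
  have h := integral_add_stdGaussian_le (s⁻¹ • (a - a')) (g := fun x => g (a' + s • x))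
    (by fun_prop) (fun x => hC _)
  have e : ∀ x, a' + s • (s⁻¹ • (a - a') + x) = a + s • x := fun x => by
    rw [smul_add, smul_inv_smul₀ hs.ne']; abel
  simp only [e] at h
  refine h.trans (le_of_eq ?_)
  congr 1
  rw [norm_smul, mul_pow, norm_inv, Real.norm_eq_abs, inv_pow, sq_abs]
  field_simp

end Gaussian

/-! ### Gaussian processes with drift and the chain rule for their entropy. -/

section Trajectory

variable {d : ℕ}

lemma measurable_snoc {E : Type*} [MeasurableSpace E] {n : ℕ} :
    Measurable fun p : (Fin n → E) × E => (Fin.snoc p.1 p.2 : Fin (n + 1) → E) := by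
  refine measurable_pi_iff.2 fun i => ?_
  induction i using Fin.lastCases with
  | last => simpa using measurable_snd
  | cast i => simpa using! (measurable_pi_apply i).comp measurable_fst

/-- The law of the first `n + 1` states of the process that starts from `ν` and moves from the past
`w` to `m n w + σ n • ξ` with a standard Gaussian `ξ`. -/
noncomputable def trajLaw (ν : Measure (Param d)) (σ : ℕ → ℝ)
    (m : (n : ℕ) → (Fin (n + 1) → Param d) → Param d) : (n : ℕ) → Measure (Fin (n + 1) → Param d)
  | 0 => ν.map fun x _ => x
  | n + 1 => ((trajLaw ν σ m n).prod (stdGaussian (Param d))).map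
      fun p => (Fin.snoc p.1 (m n p.1 + σ n • p.2) : Fin (n + 2) → Param d)

variable {ν : Measure (Param d)} [IsProbabilityMeasure ν] {σ : ℕ → ℝ}
  {m m' : (n : ℕ) → (Fin (n + 1) → Param d) → Param d}

lemma measurable_trajStep {n : ℕ} (s : ℝ) {f : (Fin (n + 1) → Param d) → Param d}
    (hf : Measurable f) :
    Measurable fun p : (Fin (n + 1) → Param d) × Param d =>
      (Fin.snoc p.1 (f p.1 + s • p.2) : Fin (n + 2) → Param d) :=
  measurable_snoc.comp (measurable_fst.prodMk
    ((hf.comp measurable_fst).add (measurable_snd.const_smul s)))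

lemma isProbabilityMeasure_trajLaw (hm : ∀ n, Measurable (m n)) (n : ℕ) :
    IsProbabilityMeasure (trajLaw ν σ m n) := by
  induction n with
  | zero => exact Measure.isProbabilityMeasure_map (by fun_prop)
  | succ n ih => exact Measure.isProbabilityMeasure_map (measurable_trajStep _ (hm n)).aemeasurable

lemma integral_trajLaw_succ (hm : ∀ n, Measurable (m n)) (n : ℕ)
    {g : (Fin (n + 2) → Param d) → ℝ} (hg : Measurable g) {C : ℝ} (hC : ∀ x, |g x| ≤ C) :
    ∫ w, g w ∂(trajLaw ν σ m (n + 1)) =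
      ∫ w, ∫ e, g (Fin.snoc w (m n w + σ n • e)) ∂(stdGaussian (Param d)) ∂(trajLaw ν σ m n) := by
  have := isProbabilityMeasure_trajLaw (ν := ν) (σ := σ) hm n
  have hs := measurable_trajStep (σ n) (hm n)
  rw [trajLaw, integral_map hs.aemeasurable hg.aestronglyMeasurable]
  exact integral_prod _ (integrable_of_abs_le (hg.comp hs) fun x => hC _)

/-- The chain rule bound for two Gaussian processes with different drifts. -/
lemma entropyLE_trajLaw (hm : ∀ n, Measurable (m n)) (hm' : ∀ n, Measurable (m' n))
    (hσ : ∀ n, 0 < σ n) (n : ℕ)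
    (hint : ∀ k < n, Integrable (fun w => ‖m k w - m' k w‖ ^ 2 / (2 * σ k ^ 2))
      (trajLaw ν σ m k)) :
    EntropyLE (trajLaw ν σ m n) (trajLaw ν σ m' n)
      (∑ k ∈ Finset.range n, ∫ w, ‖m k w - m' k w‖ ^ 2 / (2 * σ k ^ 2) ∂(trajLaw ν σ m k)) := by
  induction n with
  | zero =>
    have : IsProbabilityMeasure (trajLaw ν σ m' 0) := isProbabilityMeasure_trajLaw hm' 0
    simpa using! EntropyLE.refl (trajLaw ν σ m' 0)
  | succ n ih =>
    rintro g hg ⟨C, hC⟩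
    have i1 := isProbabilityMeasure_trajLaw (ν := ν) (σ := σ) hm n
    have i2 := isProbabilityMeasure_trajLaw (ν := ν) (σ := σ) hm' n
    have hs := measurable_trajStep (σ n) (hm n)
    have hs' := measurable_trajStep (σ n) (hm' n)
    have hδ := hint n n.lt_succ_self
    set δ : (Fin (n + 1) → Param d) → ℝ := fun w => ‖m n w - m' n w‖ ^ 2 / (2 * σ n ^ 2)
    -- `G` absorbs the last step of the reference process. It inherits the bound `C`, so the
    -- induction hypothesis applies to it, and integrating `exp G` over the reference past gives
    -- back the integral of `exp g`.
    set G : (Fin (n + 1) → Param d) → ℝ := fun w =>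
      Real.log (∫ e, Real.exp (g (Fin.snoc w (m' n w + σ n • e))) ∂(stdGaussian (Param d)))
    have hsec : ∀ w, Measurable fun e : Param d =>
        g (Fin.snoc w (m' n w + σ n • e) : Fin (n + 2) → Param d) := fun w =>
      (hg.comp hs').comp measurable_prodMk_left
    have hGm : Measurable G := by
      refine Measurable.log ?_
      exact ((hg.comp hs').exp.stronglyMeasurable.integral_prod_right'
        (ν := stdGaussian (Param d))).measurable
    have hGC : ∀ w, |G w| ≤ C := fun w => abs_log_integral_exp_le (hsec w) fun x => hC _
    have hinner : Integrable
        (fun w => ∫ e, g (Fin.snoc w (m n w + σ n • e)) ∂(stdGaussian (Param d)))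
        (trajLaw ν σ m n) :=
      (integrable_of_abs_le (P := (trajLaw ν σ m n).prod (stdGaussian (Param d)))
        (hg.comp hs) fun x => hC _).integral_prod_left
    have hGi : Integrable G (trajLaw ν σ m n) := integrable_of_abs_le hGm hGC
    have hstep : ∀ w, ∫ e, g (Fin.snoc w (m n w + σ n • e)) ∂(stdGaussian (Param d)) ≤
        δ w + G w := fun w =>
      integral_gaussian_step_le (m n w) (m' n w) (hσ n)
        (g := fun x => g (Fin.snoc w x : Fin (n + 2) → Param d))
        (hg.comp (measurable_snoc.comp measurable_prodMk_left)) fun x => hC _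
    have hexpG : ∀ w, Real.exp (G w) =
        ∫ e, Real.exp (g (Fin.snoc w (m' n w + σ n • e))) ∂(stdGaussian (Param d)) := fun w =>
      Real.exp_log (integral_exp_pos (integrable_exp_of_abs_le (hsec w) fun x => hC _))
    have hexp : ∫ w, Real.exp (G w) ∂(trajLaw ν σ m' n) =
        ∫ w, Real.exp (g w) ∂(trajLaw ν σ m' (n + 1)) := by
      rw [integral_trajLaw_succ hm' n hg.exp (C := Real.exp C)
        (fun x => by
          rw [abs_of_pos (Real.exp_pos _)]
          exact Real.exp_le_exp.2 ((le_abs_self _).trans (hC x)))]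
      simp only [hexpG]
    have hprev := ih (fun k hk => hint k (hk.trans n.lt_succ_self)) G hGm ⟨C, hGC⟩
    rw [hexp] at hprev
    have hmono := integral_mono hinner (hδ.add hGi) hstep
    simp only [Pi.add_apply] at hmono
    rw [integral_add hδ hGi] at hmono
    rw [integral_trajLaw_succ hm n hg hC, Finset.sum_range_succ]
    linarith

end Trajectory

/-! ### Resampling one coordinate of a product measure. -/

section Update

variable {ι : Type*} [Fintype ι] [DecidableEq ι] {X : ι → Type*} [∀ i, MeasurableSpace (X i)]

/-- Serves as independence of a coordinate from the others: it isolates the noise of the current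
step, and later the discarded sample of a pair. -/
lemma measurePreserving_update (μ : (i : ι) → Measure (X i)) [∀ i, IsProbabilityMeasure (μ i)]
    (i : ι) :
    MeasurePreserving (fun p : ((i : ι) → X i) × X i => Function.update p.1 i p.2)
      ((Measure.pi μ).prod (μ i)) (Measure.pi μ) := by
  have hmeas : Measurable fun p : ((i : ι) → X i) × X i => Function.update p.1 i p.2 := by
    refine measurable_pi_iff.2 fun k => ?_
    rcases eq_or_ne k i with rfl | hk
    · simpa using measurable_snd
    · simpa [hk] using! (measurable_pi_apply k).comp measurable_fst
  refine ⟨hmeas, (Measure.pi_eq fun s hs => ?_).symm⟩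
  rw [Measure.map_apply hmeas (MeasurableSet.univ_pi hs)]
  -- The overwritten coordinate is unconstrained, and its constraint passes to the fresh copy.
  have : (fun p : ((i : ι) → X i) × X i => Function.update p.1 i p.2) ⁻¹' Set.univ.pi s =
      Set.univ.pi (Function.update s i Set.univ) ×ˢ s i := by
    ext p
    simp only [Set.mem_preimage, Set.mem_univ_pi, Set.mem_prod]
    constructor
    · intro h
      refine ⟨fun k => ?_, by simpa using h i⟩
      rcases eq_or_ne k i with rfl | hk
      · simp
      · simpa [hk] using h k
    · rintro ⟨h1, h2⟩ k
      rcases eq_or_ne k i with rfl | hk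
      · simpa using h2
      · simpa [hk] using h1 k
  rw [this, Measure.prod_prod, Measure.pi_pi, ← Finset.mul_prod_erase _ _ (Finset.mem_univ i),
    ← Finset.mul_prod_erase (f := fun k => μ k (s k)) _ (Finset.mem_univ i), mul_comm]
  simp only [Function.update_self, measure_univ, one_mul]
  congr 1
  exact Finset.prod_congr rfl fun k hk => by
    rw [Function.update_of_ne (Finset.ne_of_mem_erase hk)]

end Update

/-! ### Measurability of gradients and iterates. -/

section Measurability

variable {Z : Type*} {d N T : ℕ} {loss : Param d → Z → ℝ}

lemma gradient_batchRisk (hdiff : ∀ z, Differentiable ℝ fun θ => loss θ z) (z : Fin N → Z)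
    (B : Finset (Fin N)) (θ : Param d) :
    gradient (fun θ' => batchRisk loss z B θ') θ =
      (1 / (B.card : ℝ)) • ∑ i ∈ B, gradient (fun θ' => loss θ' (z i)) θ := by
  unfold gradient batchRisk
  rw [fderiv_const_mul (DifferentiableAt.fun_sum fun i _ => hdiff _ _),
    fderiv_fun_sum fun i _ => hdiff _ _]
  simp

variable [MeasurableSpace Z]

/-- Each coordinate is a pointwise limit of difference quotients, which are jointly measurable;
continuity of the gradient plays no role. -/
lemma measurable_gradient (hloss : Measurable (Function.uncurry loss))
    (hdiff : ∀ z, Differentiable ℝ fun θ => loss θ z) :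
    Measurable fun p : Param d × Z => gradient (fun θ => loss θ p.2) p.1 := by
  have hcoord : ∀ i : Fin d,
      Measurable fun p : Param d × Z => gradient (fun θ => loss θ p.2) p.1 i := by
    intro i
    set e : Param d := EuclideanSpace.single i (1 : ℝ)
    have hlim : ∀ p : Param d × Z, Filter.Tendsto
        (fun n : ℕ => ((n : ℝ) + 1) * (loss (p.1 + ((n : ℝ) + 1)⁻¹ • e) p.2 - loss p.1 p.2))
        Filter.atTop (nhds (gradient (fun θ => loss θ p.2) p.1 i)) := by
      intro p
      have h1 : gradient (fun θ => loss θ p.2) p.1 i = fderiv ℝ (fun θ => loss θ p.2) p.1 e := by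
        have : inner ℝ (gradient (fun θ => loss θ p.2) p.1) e =
            fderiv ℝ (fun θ => loss θ p.2) p.1 e := by
          simp [gradient]
        rw [← this, EuclideanSpace.inner_single_right]
        simp
      rw [h1]
      have h2 := ((hdiff p.2 p.1).hasFDerivAt.lim (v := e) (c := fun n : ℕ => (n : ℝ) + 1)
        (l := Filter.atTop)) ?_
      · simpa using h2
      · refine tendsto_norm_atTop_atTop.comp ?_
        exact Filter.tendsto_atTop_add_const_right _ _ tendsto_natCast_atTop_atTop
    refine measurable_of_tendsto_metrizable (fun n => ?_) (tendsto_pi_nhds.2 hlim)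
    have ha : Measurable fun p : Param d × Z => loss (p.1 + ((n : ℝ) + 1)⁻¹ • e) p.2 :=
      hloss.comp ((measurable_fst.add_const _).prodMk measurable_snd)
    exact (ha.sub hloss).const_mul _
  have := (WithLp.measurable_toLp 2 (Fin d → ℝ)).comp (measurable_pi_lambda _ hcoord)
  exact this

lemma measurable_gradient_batchRisk (hloss : Measurable (Function.uncurry loss))
    (hdiff : ∀ z, Differentiable ℝ fun θ => loss θ z) (B : Finset (Fin N)) :
    Measurable fun p : Param d × (Fin N → Z) =>
      gradient (fun θ' => batchRisk loss p.2 B θ') p.1 := by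
  simp only [gradient_batchRisk hdiff]
  refine (Finset.measurable_fun_sum _ fun i _ => ?_).const_smul (1 / (B.card : ℝ))
  exact (measurable_gradient hloss hdiff).comp
    (measurable_fst.prodMk ((measurable_pi_apply i).comp measurable_snd))

lemma measurable_incoherence (hloss : Measurable (Function.uncurry loss))
    (hdiff : ∀ z, Differentiable ℝ fun θ => loss θ z) (j : Fin N) :
    Measurable fun p : Param d × (Fin (N + N) → Z) => incoherence loss p.2 j p.1 :=
  ((measurable_gradient hloss hdiff).comp
    (measurable_fst.prodMk ((measurable_pi_apply _).comp measurable_snd))).sub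
  ((measurable_gradient hloss hdiff).comp
    (measurable_fst.prodMk ((measurable_pi_apply _).comp measurable_snd)))

lemma measurable_dataset (u : Fin N → Bool) :
    Measurable fun s : Fin (N + N) → Z => dataset s u :=
  measurable_pi_lambda _ fun _ => measurable_pi_apply _

lemma measurable_sgld (hloss : Measurable (Function.uncurry loss))
    (hdiff : ∀ z, Differentiable ℝ fun θ => loss θ z) (η σ : Fin T → ℝ)
    (v : Fin T → Finset (Fin N)) :
    Measurable fun p : (Fin N → Z) × Param d × (Fin T → Param d) =>
      sgld loss η σ p.1 v p.2.1 p.2.2 := by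
  refine measurable_pi_lambda _ fun k => ?_
  induction k using Fin.induction with
  | zero => exact measurable_fst.comp measurable_snd
  | succ t ih =>
    simp only [sgld, Fin.induction_succ] at ih ⊢
    have hgr := (measurable_gradient_batchRisk hloss hdiff (v t)).comp
      (ih.prodMk (measurable_fst (α := Fin N → Z) (β := Param d × (Fin T → Param d))))
    have hε : Measurable fun p : (Fin N → Z) × Param d × (Fin T → Param d) => p.2.2 t :=
      (measurable_pi_apply t).comp (measurable_snd.comp measurable_snd)
    exact (ih.sub (hgr.const_smul (η t))).add (hε.const_smul (σ t))

/-- The iterates as a function of super-sample, selection, batches, initialization and noise. -/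
noncomputable def iterates (loss : Param d → Z → ℝ) (η σ : Fin T → ℝ)
    (x : (Fin (N + N) → Z) × (Fin N → Bool) × (Fin T → Finset (Fin N)))
    (n : Param d × (Fin T → Param d)) : Fin (T + 1) → Param d :=
  sgld loss η σ (dataset x.1 x.2.1) x.2.2 n.1 n.2

/-- Selection and batches take finitely many values, so they can be frozen when measurability is
checked. -/
lemma measurable_of_discrete {α β γ δ : Type*} [MeasurableSpace α] [MeasurableSpace β]
    [MeasurableSpace γ] [MeasurableSpace δ] [Countable β] [MeasurableSingletonClass β]
    {f : (α × β) × γ → δ} (hf : ∀ y, Measurable fun p : α × γ => f ((p.1, y), p.2)) :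
    Measurable f := by
  have h : Measurable fun q : β × α × γ => f ((q.2.1, q.1), q.2.2) :=
    measurable_from_prod_countable_right hf
  exact h.comp ((measurable_snd.comp measurable_fst).prodMk
    ((measurable_fst.comp measurable_fst).prodMk measurable_snd))

lemma measurable_iterates (hloss : Measurable (Function.uncurry loss))
    (hdiff : ∀ z, Differentiable ℝ fun θ => loss θ z) (η σ : Fin T → ℝ) :
    Measurable fun p : ((Fin (N + N) → Z) × (Fin N → Bool) × (Fin T → Finset (Fin N))) ×
      (Param d × (Fin T → Param d)) => iterates loss η σ p.1 p.2 :=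
  measurable_of_discrete fun y => (measurable_sgld hloss hdiff η σ y.2).comp
    (((measurable_dataset y.1).comp measurable_fst).prodMk measurable_snd)

end Measurability

/-! ### SGLD with fixed data and batches as a Gaussian process. -/

section Law

variable {Z : Type*} {d N T : ℕ} {loss : Param d → Z → ℝ}

lemma sgld_succ (η σ : Fin T → ℝ) (z : Fin N → Z) (v : Fin T → Finset (Fin N)) (θ₀ : Param d)
    (ε : Fin T → Param d) (t : Fin T) :
    sgld loss η σ z v θ₀ ε t.succ = sgld loss η σ z v θ₀ ε t.castSucc
      - η t • gradient (fun θ' => batchRisk loss z (v t) θ') (sgld loss η σ z v θ₀ ε t.castSucc)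
      + σ t • ε t := rfl

/-- Causality. For the noise it shows that a fresh vector leaves the past unchanged; for the batches
it permits conditioning on past batches only. -/
lemma sgld_congr (η σ : Fin T → ℝ) (z : Fin N → Z) {v v' : Fin T → Finset (Fin N)}
    (θ₀ : Param d) {ε ε' : Fin T → Param d} (k : Fin (T + 1))
    (hv : ∀ i : Fin T, i.val < k.val → v i = v' i)
    (hε : ∀ i : Fin T, i.val < k.val → ε i = ε' i) :
    sgld loss η σ z v θ₀ ε k = sgld loss η σ z v' θ₀ ε' k := by
  induction k using Fin.induction with
  | zero => rfl
  | succ t ih =>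
    have ht : t.val < t.succ.val := by simp
    rw [sgld_succ, sgld_succ, hv t ht, hε t ht,
      ih (fun i hi => hv i (hi.trans ht)) (fun i hi => hε i (hi.trans ht))]

/-- The first `n + 1` states of a trajectory. -/
def initialPart {E : Type*} {T n : ℕ} (h : n ≤ T) (θ : Fin (T + 1) → E) : Fin (n + 1) → E :=
  fun k => θ (k.castLE (Nat.succ_le_succ h))

lemma measurable_initialPart {E : Type*} [MeasurableSpace E] {T n : ℕ} (h : n ≤ T) :
    Measurable (initialPart h : (Fin (T + 1) → E) → _) :=
  measurable_pi_lambda _ fun _ => measurable_pi_apply _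

/-- The noise levels, continued by one. -/
noncomputable def noiseLevel (σ : Fin T → ℝ) (n : ℕ) : ℝ := if h : n < T then σ ⟨n, h⟩ else 1

/-- One step with the drift given by `G`; no movement after the last step. -/
noncomputable def stepMean (η : Fin T → ℝ)
    (G : (t : Fin T) → (Fin (t.val + 1) → Param d) → Param d) (n : ℕ)
    (w : Fin (n + 1) → Param d) : Param d :=
  if h : n < T then w (Fin.last n) - η ⟨n, h⟩ • G ⟨n, h⟩ w else w (Fin.last n)

lemma measurable_stepMean {η : Fin T → ℝ}
    {G : (t : Fin T) → (Fin (t.val + 1) → Param d) → Param d} (hG : ∀ t, Measurable (G t))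
    (n : ℕ) : Measurable (stepMean η G n) := by
  unfold stepMean
  split_ifs with h
  · exact (measurable_pi_apply _).sub ((hG ⟨n, h⟩).const_smul (η ⟨n, h⟩))
  · exact measurable_pi_apply _

/-- The gradient of the batch risk, as a function of the past. -/
noncomputable def batchGradient (loss : Param d → Z → ℝ) (z : Fin N → Z)
    (v : Fin T → Finset (Fin N)) (t : Fin T) (w : Fin (t.val + 1) → Param d) : Param d :=
  gradient (fun θ' => batchRisk loss z (v t) θ') (w (Fin.last t.val))

lemma initialPart_sgld_succ (η σ : Fin T → ℝ) (z : Fin N → Z) (v : Fin T → Finset (Fin N))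
    (θ₀ : Param d) (ε : Fin T → Param d) {n : ℕ} (h : n + 1 ≤ T) :
    initialPart h (sgld loss η σ z v θ₀ ε) =
      Fin.snoc (initialPart (Nat.le_of_succ_le h) (sgld loss η σ z v θ₀ ε))
        (stepMean η (batchGradient loss z v) n
          (initialPart (Nat.le_of_succ_le h) (sgld loss η σ z v θ₀ ε))
          + noiseLevel σ n • ε ⟨n, h⟩) := by
  ext1 k
  induction k using Fin.lastCases with
  | last =>
    have hn : n < T := h
    simp only [Fin.snoc_last, stepMean, noiseLevel, hn, dif_pos]
    exact sgld_succ η σ z v θ₀ ε ⟨n, h⟩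
  | cast k =>
    rw [Fin.snoc_castSucc]
    rfl

variable [MeasurableSpace Z]

lemma measurable_batchGradient (hloss : Measurable (Function.uncurry loss))
    (hdiff : ∀ z, Differentiable ℝ fun θ => loss θ z) (z : Fin N → Z)
    (v : Fin T → Finset (Fin N)) (t : Fin T) :
    Measurable (batchGradient loss z v t) := by
  have h : Measurable fun w : Fin (t.val + 1) → Param d => (w (Fin.last t.val), z) :=
    (measurable_pi_apply _).prodMk measurable_const
  have h' := (measurable_gradient_batchRisk hloss hdiff (v t)).comp h
  unfold batchGradient
  exact h'

/-- The law of the noise: initialization and Gaussian vectors. -/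
noncomputable def noiseLaw (ν : Measure (Param d)) (T : ℕ) :
    Measure (Param d × (Fin T → Param d)) :=
  ν.prod (Measure.pi fun _ : Fin T => stdGaussian (Param d))

instance (ν : Measure (Param d)) [IsProbabilityMeasure ν] :
    IsProbabilityMeasure (noiseLaw ν T) := by
  unfold noiseLaw; infer_instance

/-- All noise is drawn at once on the left and step by step on the right. Resampling the vector of
the current step keeps the joint law, leaves the past untouched by causality, and makes the step use
a fresh independent Gaussian. -/
lemma map_initialPart_sgld (ν : Measure (Param d)) [IsProbabilityMeasure ν]
    (hloss : Measurable (Function.uncurry loss))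
    (hdiff : ∀ z, Differentiable ℝ fun θ => loss θ z) (η σ : Fin T → ℝ) (z : Fin N → Z)
    (v : Fin T → Finset (Fin N)) {n : ℕ} (h : n ≤ T) :
    (noiseLaw ν T).map (fun p => initialPart h (sgld loss η σ z v p.1 p.2)) =
      trajLaw ν (noiseLevel σ) (stepMean η (batchGradient loss z v)) n := by
  have hW : Measurable fun p : Param d × (Fin T → Param d) => sgld loss η σ z v p.1 p.2 :=
    (measurable_sgld hloss hdiff η σ v).comp measurable_prodMk_left
  induction n with
  | zero =>
    have : (fun p : Param d × (Fin T → Param d) => initialPart h (sgld loss η σ z v p.1 p.2)) =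
        (fun (x : Param d) (_ : Fin 1) => x) ∘ Prod.fst := by
      ext1 p; ext1 k
      have hk : k = 0 := Fin.eq_zero k
      subst hk
      rfl
    rw [this, ← Measure.map_map (by fun_prop) measurable_fst, noiseLaw, trajLaw]
    congr 1
    exact (measurePreserving_fst (μ := ν)).map_eq
  | succ n ih =>
    have hn : n < T := h
    set i : Fin T := ⟨n, hn⟩
    have hup := (((MeasurePreserving.id ν).prod
      (measurePreserving_update (fun _ : Fin T => stdGaussian (Param d)) i)).comp
      (measurePreserving_prodAssoc ν (Measure.pi fun _ : Fin T => stdGaussian (Param d))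
        (stdGaussian (Param d))))
    have hmeas : Measurable fun p : Param d × (Fin T → Param d) =>
        initialPart h (sgld loss η σ z v p.1 p.2) := (measurable_initialPart h).comp hW
    have hmeas' : Measurable fun p : Param d × (Fin T → Param d) =>
        initialPart hn.le (sgld loss η σ z v p.1 p.2) := (measurable_initialPart hn.le).comp hW
    have hstep := measurable_trajStep (noiseLevel σ n) (measurable_stepMean (η := η)
      (measurable_batchGradient hloss hdiff z v) n)
    rw [trajLaw, ← ih hn.le, noiseLaw, ← hup.map_eq, Measure.map_map hmeas hup.measurable]
    have hprod := Measure.map_prod_map (ν.prod (Measure.pi fun _ : Fin T => stdGaussian (Param d)))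
      (stdGaussian (Param d)) hmeas' measurable_id
    rw [Measure.map_id] at hprod
    rw [hup.map_eq, hprod, Measure.map_map hstep (hmeas'.prodMap measurable_id)]
    congr 1
    ext1 p
    have hpast : initialPart hn.le (sgld loss η σ z v p.1.1 (Function.update p.1.2 i p.2)) =
        initialPart hn.le (sgld loss η σ z v p.1.1 p.1.2) := by
      ext1 k
      refine sgld_congr η σ z _ _ (fun _ _ => rfl) fun l hl => ?_
      have : l ≠ i := fun hli => by
        subst hli
        have := k.isLt
        simp only [Fin.val_castLE, i] at hl
        omega
      rw [Function.update_of_ne this]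
    refine (initialPart_sgld_succ η σ z v p.1.1 (Function.update p.1.2 i p.2) h).trans ?_
    rw [hpast, Function.update_self]
    rfl

end Law

/-! ### The reference process and the deviation from it. -/

section Prior

variable {Z : Type*} {d N T : ℕ} {loss : Param d → Z → ℝ}

/-- The batch gradient in which the contribution of the sample `j` is replaced by the average of
the two candidates with weights `1 - p` and `p`. -/
noncomputable def priorGradient (loss : Param d → Z → ℝ) (s : Fin (N + N) → Z) (u : Fin N → Bool)
    (v : Fin T → Finset (Fin N)) (j : Fin N) (p : (t : Fin T) → (Fin (t.val + 1) → Param d) → ℝ)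
    (t : Fin T) (w : Fin (t.val + 1) → Param d) : Param d :=
  (1 / ((v t).card : ℝ)) • ∑ i ∈ v t,
    if i = j then
      (1 - p t w) • gradient (fun θ => loss θ (s (superIndex j false))) (w (Fin.last t.val))
        + p t w • gradient (fun θ => loss θ (s (superIndex j true))) (w (Fin.last t.val))
    else gradient (fun θ => loss θ (s (superIndex i (u i)))) (w (Fin.last t.val))

/-- The reference drift is blind to `u j`, which later lets both selections of the sample `j` share
one reference law. -/
lemma priorGradient_congr {s : Fin (N + N) → Z} {u u' : Fin N → Bool}
    {v : Fin T → Finset (Fin N)} {j : Fin N} (h : ∀ i, i ≠ j → u i = u' i)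
    (p : (t : Fin T) → (Fin (t.val + 1) → Param d) → ℝ) :
    priorGradient loss s u v j p = priorGradient loss s u' v j p := by
  ext1 t; ext1 w
  unfold priorGradient
  congr 1
  refine Finset.sum_congr rfl fun i _ => ?_
  split_ifs with hi
  · rfl
  · rw [h i hi]

lemma batchGradient_sub_priorGradient (hdiff : ∀ z, Differentiable ℝ fun θ => loss θ z)
    (s : Fin (N + N) → Z) (u : Fin N → Bool) (v : Fin T → Finset (Fin N)) (j : Fin N)
    (p : (t : Fin T) → (Fin (t.val + 1) → Param d) → ℝ) (t : Fin T)
    (w : Fin (t.val + 1) → Param d) :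
    batchGradient loss (dataset s u) v t w - priorGradient loss s u v j p t w =
      if j ∈ v t then ((1 / ((v t).card : ℝ)) * (p t w - bit (u j))) •
        incoherence loss s j (w (Fin.last t.val)) else 0 := by
  unfold batchGradient priorGradient
  rw [gradient_batchRisk hdiff, ← smul_sub, ← Finset.sum_sub_distrib]
  have hterm : ∀ i ∈ v t,
      gradient (fun θ => loss θ (dataset s u i)) (w (Fin.last t.val)) -
        (if i = j then
          (1 - p t w) • gradient (fun θ => loss θ (s (superIndex j false))) (w (Fin.last t.val))
            + p t w • gradient (fun θ => loss θ (s (superIndex j true))) (w (Fin.last t.val))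
        else gradient (fun θ => loss θ (s (superIndex i (u i)))) (w (Fin.last t.val))) =
      if i = j then (p t w - bit (u j)) • incoherence loss s j (w (Fin.last t.val)) else 0 := by
    intro i _
    split_ifs with hi
    · subst hi
      unfold incoherence dataset
      cases u i <;> simp only [bit, if_true, Bool.false_eq_true, if_false] <;> module
    · exact sub_self _
  rw [Finset.sum_congr rfl hterm, Finset.sum_ite_eq']
  split_ifs
  · rw [smul_smul]
  · rw [smul_zero]

/-- All samples other than `j` cancel in the drift difference, and the sign of `p - U_j` is lost in
the square. Steps whose batch misses `j` cost no entropy, hence the sum over `stepsWith`. -/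
lemma norm_stepMean_sub_sq (hdiff : ∀ z, Differentiable ℝ fun θ => loss θ z)
    (η σ : Fin T → ℝ) (s : Fin (N + N) → Z) (u : Fin N → Bool)
    (v : Fin T → Finset (Fin N)) (j : Fin N)
    (p : (t : Fin T) → (Fin (t.val + 1) → Param d) → ℝ) (t : Fin T)
    (w : Fin (t.val + 1) → Param d) :
    ‖stepMean η (batchGradient loss (dataset s u) v) t.val w -
        stepMean η (priorGradient loss s u v j p) t.val w‖ ^ 2 / (2 * noiseLevel σ t.val ^ 2) =
      if j ∈ v t then summand loss η σ s u v j t (w (Fin.last t.val)) (p t w) else 0 := by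
  simp only [stepMean, noiseLevel, t.isLt, dif_pos, Fin.eta]
  rw [sub_sub_sub_cancel_left, ← smul_sub, norm_smul, mul_pow, norm_sub_rev,
    batchGradient_sub_priorGradient hdiff]
  split_ifs with hj
  · rw [norm_smul, mul_pow, Real.norm_eq_abs, Real.norm_eq_abs, sq_abs, sq_abs, summand]
    ring
  · simp

lemma summand_nonneg (η σ : Fin T → ℝ) (s : Fin (N + N) → Z) (u : Fin N → Bool)
    (v : Fin T → Finset (Fin N)) (j : Fin N) (t : Fin T) (θ : Param d) (p : ℝ) :
    0 ≤ summand loss η σ s u v j t θ p := by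
  unfold summand; positivity

variable [MeasurableSpace Z]

lemma measurable_priorGradient (hloss : Measurable (Function.uncurry loss))
    (hdiff : ∀ z, Differentiable ℝ fun θ => loss θ z) (s : Fin (N + N) → Z) (u : Fin N → Bool)
    (v : Fin T → Finset (Fin N)) (j : Fin N)
    {p : (t : Fin T) → (Fin (t.val + 1) → Param d) → ℝ} (hp : ∀ t, Measurable (p t))
    (t : Fin T) : Measurable (priorGradient loss s u v j p t) := by
  have hg : ∀ z : Z, Measurable fun w : Fin (t.val + 1) → Param d =>
      gradient (fun θ => loss θ z) (w (Fin.last t.val)) := fun z => by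
    have h : Measurable fun w : Fin (t.val + 1) → Param d => (w (Fin.last t.val), z) :=
      (measurable_pi_apply _).prodMk measurable_const
    exact (measurable_gradient hloss hdiff).comp h
  unfold priorGradient
  refine (Finset.measurable_fun_sum _ fun i _ => ?_).const_smul (1 / ((v t).card : ℝ))
  split_ifs
  · exact (((hp t).const_sub 1).smul (hg _)).add ((hp t).smul (hg _))
  · exact hg _

lemma measurable_summand (hloss : Measurable (Function.uncurry loss))
    (hdiff : ∀ z, Differentiable ℝ fun θ => loss θ z) (η σ : Fin T → ℝ) (u : Fin N → Bool)
    (v : Fin T → Finset (Fin N)) (j : Fin N) (t : Fin T) :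
    Measurable fun q : (Fin (N + N) → Z) × Param d × ℝ =>
      summand loss η σ q.1 u v j t q.2.1 q.2.2 := by
  have h : Measurable fun q : (Fin (N + N) → Z) × Param d × ℝ =>
      incoherence loss q.1 j q.2.1 :=
    (measurable_incoherence hloss hdiff j).comp
      ((measurable_fst.comp measurable_snd).prodMk measurable_fst)
  have hp : Measurable fun q : (Fin (N + N) → Z) × Param d × ℝ => q.2.2 :=
    measurable_snd.comp measurable_snd
  have h1 : Measurable fun q : (Fin (N + N) → Z) × Param d × ℝ =>
      η t ^ 2 * ‖incoherence loss q.1 j q.2.1‖ ^ 2 / (2 * σ t ^ 2 * ((v t).card : ℝ) ^ 2) :=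
    ((h.norm.pow_const 2).const_mul _).div_const _
  have h2 : Measurable fun q : (Fin (N + N) → Z) × Param d × ℝ => (bit (u j) - q.2.2) ^ 2 :=
    (hp.const_sub _).pow_const 2
  exact h1.mul h2

/-- The effect on a bounded function of replacing the gradient of the sample `j` by its prior. -/
lemma abs_integral_sub_prior_le (ν : Measure (Param d)) [IsProbabilityMeasure ν]
    (hloss : Measurable (Function.uncurry loss))
    (hdiff : ∀ z, Differentiable ℝ fun θ => loss θ z) (η : Fin T → ℝ) {σ : Fin T → ℝ}
    (hσ : ∀ t, 0 < σ t) (s : Fin (N + N) → Z) (u : Fin N → Bool)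
    (v : Fin T → Finset (Fin N)) (j : Fin N)
    {p : (t : Fin T) → (Fin (t.val + 1) → Param d) → ℝ} (hp : ∀ t, Measurable (p t))
    {f : Param d → ℝ} (hf : Measurable f) {c : ℝ} (hc : ∀ θ, |f θ| ≤ c) :
    ENNReal.ofReal |∫ w, f (w (Fin.last T)) ∂(trajLaw ν (noiseLevel σ)
          (stepMean η (batchGradient loss (dataset s u) v)) T)
        - ∫ w, f (w (Fin.last T)) ∂(trajLaw ν (noiseLevel σ)
          (stepMean η (priorGradient loss s u v j p)) T)| ≤
      ENNReal.ofReal (√2 * c) * (∑ t ∈ stepsWith v j,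
        ∫⁻ w, ENNReal.ofReal (summand loss η σ s u v j t (w (Fin.last t.val)) (p t w))
          ∂(trajLaw ν (noiseLevel σ) (stepMean η (batchGradient loss (dataset s u) v)) t.val))
        ^ (1 / 2 : ℝ) := by
  set m := stepMean η (batchGradient loss (dataset s u) v)
  set m' := stepMean η (priorGradient loss s u v j p)
  have hm : ∀ n, Measurable (m n) :=
    measurable_stepMean (measurable_batchGradient hloss hdiff _ v)
  have hm' : ∀ n, Measurable (m' n) :=
    measurable_stepMean (measurable_priorGradient hloss hdiff s u v j hp)
  have hσ' : ∀ n, 0 < noiseLevel σ n := fun n => by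
    unfold noiseLevel
    split_ifs
    exacts [hσ _, one_pos]
  have hprob : ∀ n, IsProbabilityMeasure (trajLaw ν (noiseLevel σ) m n) :=
    isProbabilityMeasure_trajLaw hm
  have hprob' : ∀ n, IsProbabilityMeasure (trajLaw ν (noiseLevel σ) m' n) :=
    isProbabilityMeasure_trajLaw hm'
  set I : Fin T → ℝ≥0∞ := fun t =>
    ∫⁻ w, ENNReal.ofReal (summand loss η σ s u v j t (w (Fin.last t.val)) (p t w))
      ∂(trajLaw ν (noiseLevel σ) m t.val)
  have hc0 : 0 ≤ c := (abs_nonneg _).trans (hc 0)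
  -- This case precedes that of an infinite sum because `0 * ∞ = 0`: the right-hand side would then
  -- not be infinite.
  rcases hc0.eq_or_lt with rfl | hcpos
  · have : f = 0 := by ext x; simpa using hc x
    simp [this]
  -- An infinite sum makes the bound trivial; a finite one supplies the integrability that the chain
  -- rule requires.
  by_cases htop : ∑ t ∈ stepsWith v j, I t = ∞
  · rw [htop, ENNReal.top_rpow_of_pos (by norm_num), ENNReal.mul_top]
    · exact le_top
    · simpa using hcpos
  have hI : ∀ t ∈ stepsWith v j, I t ≠ ∞ := fun t ht h => htop (ENNReal.sum_eq_top.2 ⟨t, ht, h⟩)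
  have hsm : ∀ t, Measurable fun w : Fin (t.val + 1) → Param d =>
      summand loss η σ s u v j t (w (Fin.last t.val)) (p t w) := fun t => by
    have h : Measurable fun w : Fin (t.val + 1) → Param d => (s, w (Fin.last t.val), p t w) :=
      measurable_const.prodMk ((measurable_pi_apply _).prodMk (hp t))
    have h' := (measurable_summand hloss hdiff η σ u v j t).comp h
    exact h'
  have hnn : ∀ t (w : Fin (t.val + 1) → Param d),
      0 ≤ summand loss η σ s u v j t (w (Fin.last t.val)) (p t w) :=
    fun t w => summand_nonneg η σ s u v j t _ _
  have hint : ∀ t ∈ stepsWith v j, Integrable (fun w : Fin (t.val + 1) → Param d =>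
      summand loss η σ s u v j t (w (Fin.last t.val)) (p t w))
      (trajLaw ν (noiseLevel σ) m t.val) := fun t ht =>
    ⟨(hsm t).aestronglyMeasurable, by
      rw [hasFiniteIntegral_iff_ofReal (ae_of_all _ (hnn t))]
      exact (hI t ht).lt_top⟩
  have hmem : ∀ t, t ∈ stepsWith v j ↔ j ∈ v t := fun t => by simp [stepsWith]
  have hsq := norm_stepMean_sub_sq (loss := loss) hdiff η σ s u v j p
  have hint' : ∀ k < T, Integrable
      (fun w => ‖m k w - m' k w‖ ^ 2 / (2 * noiseLevel σ k ^ 2))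
      (trajLaw ν (noiseLevel σ) m k) := fun k hk => by
    by_cases hj : j ∈ v ⟨k, hk⟩
    · refine (hint ⟨k, hk⟩ ((hmem _).2 hj)).congr (ae_of_all _ fun w => ?_)
      exact ((hsq ⟨k, hk⟩ w).trans (if_pos hj)).symm
    · refine (integrable_zero _ _ _).congr (ae_of_all _ fun w => ?_)
      exact ((hsq ⟨k, hk⟩ w).trans (if_neg hj)).symm
  have hent := entropyLE_trajLaw (ν := ν) hm hm' hσ' T hint'
  have hsum : ∑ k ∈ Finset.range T, ∫ w, ‖m k w - m' k w‖ ^ 2 / (2 * noiseLevel σ k ^ 2)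
      ∂(trajLaw ν (noiseLevel σ) m k) = (∑ t ∈ stepsWith v j, I t).toReal := by
    rw [Finset.sum_range, ENNReal.toReal_sum hI, stepsWith, Finset.sum_filter]
    refine Finset.sum_congr rfl fun t _ => ?_
    rw [integral_congr_ae (ae_of_all _ (hsq t))]
    split_ifs with hj
    · exact integral_eq_lintegral_of_nonneg_ae (ae_of_all _ (hnn t)) (hsm t).aestronglyMeasurable
    · simp
  rw [hsum] at hent
  have hfm : Measurable fun w : Fin (T + 1) → Param d => f (w (Fin.last T)) :=
    hf.comp (measurable_pi_apply _)
  have h1 := hent.integral_sub_le ENNReal.toReal_nonneg hfm fun w => hc _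
  -- Pinsker for `-f` gives the other half of the absolute value.
  have h2 := hent.integral_sub_le ENNReal.toReal_nonneg hfm.neg (c := c)
    fun w => by simpa using hc (w (Fin.last T))
  simp only [Pi.neg_apply, integral_neg] at h2
  refine (ENNReal.ofReal_le_ofReal (abs_le.2 ⟨?_, h1⟩)).trans (le_of_eq ?_)
  · linarith
  · rw [ENNReal.ofReal_mul (by positivity), Real.sqrt_eq_rpow (ENNReal.toReal _),
      ← ENNReal.ofReal_rpow_of_nonneg ENNReal.toReal_nonneg (by norm_num),
      ENNReal.ofReal_toReal htop]

end Prior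

/-! ### Conditional laws, reversal of a fair bit, and integration over a coordinate. -/

section Tools

variable {α β γ Ω : Type*} [MeasurableSpace α] [MeasurableSpace β] [MeasurableSpace γ]
  [MeasurableSpace Ω]

/-- The conditional law of `F (X, Y)` given `X` when `Y` is independent of `X` with law `τ`. -/
lemma condDistrib_of_prod_law [StandardBorelSpace γ] [Nonempty γ] {μ : Measure Ω}
    [IsProbabilityMeasure μ] {X : Ω → α} {Y : Ω → β} {τ : Measure β} [IsProbabilityMeasure τ]
    (hX : AEMeasurable X μ) (hY : AEMeasurable Y μ)
    (h : μ.map (fun ω => (X ω, Y ω)) = (μ.map X).prod τ) {F : α × β → γ} (hF : Measurable F) :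
    condDistrib (fun ω => F (X ω, Y ω)) X μ =ᵐ[μ.map X] fun x => τ.map fun y => F (x, y) := by
  set κ : Kernel α γ := (Kernel.id ×ₖ Kernel.const α τ).map F with hκ
  have hκx : ∀ x, κ x = τ.map fun y => F (x, y) := fun x => by
    rw [hκ, Kernel.map_apply _ hF, Kernel.prod_apply, Kernel.id_apply, Kernel.const_apply,
      Measure.dirac_prod, Measure.map_map hF measurable_prodMk_left]
    rfl
  have : IsMarkovKernel κ := Kernel.IsMarkovKernel.map _ hF
  have hXY : AEMeasurable (fun ω => (X ω, Y ω)) μ := hX.prodMk hY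
  -- By uniqueness of the disintegration it suffices to match the joint laws.
  have key := condDistrib_ae_eq_of_measure_eq_compProd (μ := μ) X
    (Y := fun ω => F (X ω, Y ω)) (hF.comp_aemeasurable hXY) (κ := κ) ?_
  · filter_upwards [key] with x hx
    rw [hx, hκx]
  have hG : Measurable fun q : α × β => (q.1, F q) := measurable_fst.prodMk hF
  have : IsProbabilityMeasure (μ.map X) := Measure.isProbabilityMeasure_map hX
  have h1 : μ.map (fun ω => (X ω, F (X ω, Y ω))) =
      ((μ.map X).prod τ).map fun q => (q.1, F q) := by
    rw [← h, AEMeasurable.map_map_of_aemeasurable hG.aemeasurable hXY]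
    rfl
  rw [h1]
  refine Measure.ext_of_lintegral _ fun f hf => ?_
  have hfG : Measurable fun q : α × β => f (q.1, F q) := hf.comp hG
  rw [lintegral_map hf hG, lintegral_prod _ hfG.aemeasurable, Measure.lintegral_compProd hf]
  refine lintegral_congr fun x => ?_
  have hfx : Measurable fun z => f (x, z) := hf.comp measurable_prodMk_left
  have hFx : Measurable fun y => F (x, y) := hF.comp measurable_prodMk_left
  rw [hκx, lintegral_map hfx hFx]

lemma ofReal_integral_le_lintegral_ofReal {μ : Measure α} {f : α → ℝ} (hf : Integrable f μ) :
    ENNReal.ofReal (∫ x, f x ∂μ) ≤ ∫⁻ x, ENNReal.ofReal (f x) ∂μ := by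
  have h := ofReal_integral_eq_lintegral_ofReal hf.pos_part (ae_of_all _ fun x => le_max_right _ _)
  have h2 : ∀ x, ENNReal.ofReal (max (f x) 0) = ENNReal.ofReal (f x) := fun x => by
    simp [ENNReal.ofReal_max]
  simp only [h2] at h
  rw [← h]
  exact ENNReal.ofReal_le_ofReal (integral_mono hf hf.pos_part fun x => le_max_left _ _)

lemma measurePreserving_not :
    MeasurePreserving Bool.not (uniformOn (Set.univ : Set Bool)) (uniformOn Set.univ) := by
  refine ⟨measurable_of_countable _, Measure.ext_of_singleton fun b => ?_⟩
  rw [Measure.map_apply (measurable_of_countable _) (measurableSet_singleton b)]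
  have : Bool.not ⁻¹' {b} = {!b} := by
    ext c; cases b <;> cases c <;> simp
  rw [this, uniformOn_univ, uniformOn_univ]
  simp

instance : IsProbabilityMeasure (uniformOn (Set.univ : Set Bool)) :=
  isProbabilityMeasure_uniformOn Set.finite_univ Set.univ_nonempty

lemma measurePreserving_flip {N : ℕ} (j : Fin N) :
    MeasurePreserving (fun u : Fin N → Bool => Function.update u j (!(u j)))
      (Measure.pi fun _ : Fin N => uniformOn (Set.univ : Set Bool))
      (Measure.pi fun _ : Fin N => uniformOn (Set.univ : Set Bool)) := by
  have h := measurePreserving_pi (fun _ : Fin N => uniformOn (Set.univ : Set Bool))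
    (fun _ : Fin N => uniformOn (Set.univ : Set Bool))
    (f := fun i => if i = j then Bool.not else id) fun i => by
      split_ifs
      exacts [measurePreserving_not, MeasurePreserving.id _]
  convert h using 1
  ext u i
  rcases eq_or_ne i j with rfl | hi
  · simp
  · simp [hi]

/-- Integrating out a coordinate on which the first argument does not depend. -/
lemma integral_pi_coordinate {n : ℕ} (P : Measure α) [IsProbabilityMeasure P] (i : Fin n)
    {g : (Fin n → α) → β} (hg : Measurable g)
    (hgi : ∀ s z, g (Function.update s i z) = g s) {h : β → α → ℝ}
    (hh : Measurable (Function.uncurry h)) {C : ℝ} (hC : ∀ y z, |h y z| ≤ C) :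
    ∫ s, ∫ z, h (g s) z ∂P ∂(Measure.pi fun _ : Fin n => P) =
      ∫ s, h (g s) (s i) ∂(Measure.pi fun _ : Fin n => P) := by
  have hup := measurePreserving_update (fun _ : Fin n => P) i
  have hm : Measurable fun s : Fin n → α => h (g s) (s i) :=
    hh.comp (hg.prodMk (measurable_pi_apply i))
  have hm2 : Measurable fun q : (Fin n → α) × α => h (g q.1) q.2 :=
    hh.comp ((hg.comp measurable_fst).prodMk measurable_snd)
  conv_rhs => rw [← hup.map_eq]
  rw [integral_map hup.measurable.aemeasurable hm.aestronglyMeasurable]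
  simp only [hgi, Function.update_self]
  exact (integral_prod _ (integrable_of_abs_le hm2 fun q => hC _ _)).symm

lemma lintegral_uniformOn_prod {N : ℕ} {π : Measure α} [SFinite π] {f : Fin N × α → ℝ≥0∞}
    (hf : Measurable f) :
    ∫⁻ q, f q ∂((uniformOn (Set.univ : Set (Fin N))).prod π) =
      ∑ j, (N : ℝ≥0∞)⁻¹ * ∫⁻ x, f (j, x) ∂π := by
  rw [lintegral_prod _ hf.aemeasurable, lintegral_fintype]
  refine Finset.sum_congr rfl fun j _ => ?_
  rw [mul_comm, uniformOn_univ]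
  simp

end Tools

/-! ### The gap within a pair and its symmetrization. -/

section MeanGap

variable {Z : Type*} {d N T : ℕ} {loss : Param d → Z → ℝ}

/-- Super-sample, selection and batches. -/
abbrev Config (Z : Type*) (N T : ℕ) : Type _ :=
  (Fin (N + N) → Z) × (Fin N → Bool) × (Fin T → Finset (Fin N))

/-- The configuration with the selection of the sample `j` reversed. -/
def flip (j : Fin N) (x : Config Z N T) : Config Z N T :=
  (x.1, Function.update x.2.1 j (!(x.2.1 j)), x.2.2)

/-- The loss at the discarded minus the loss at the selected sample of the pair `j`. -/
noncomputable def ghostGap (loss : Param d → Z → ℝ) (j : Fin N) (x : Config Z N T)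
    (θ : Param d) : ℝ :=
  loss θ (x.1 (superIndex j (!(x.2.1 j)))) - loss θ (x.1 (superIndex j (x.2.1 j)))

/-- The parameter is held fixed here; for SGLD itself it would change with the selection, which is
why the reference process is needed. -/
lemma ghostGap_flip (j : Fin N) (x : Config Z N T) (θ : Param d) :
    ghostGap loss j (flip j x) θ = - ghostGap loss j x θ := by
  simp [ghostGap, flip]

lemma abs_ghostGap_le {a b : ℝ} (hab : ∀ θ z, loss θ z ∈ Set.Icc a b) (j : Fin N)
    (x : Config Z N T) (θ : Param d) : |ghostGap loss j x θ| ≤ b - a := by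
  have h1 := hab θ (x.1 (superIndex j (!(x.2.1 j))))
  have h2 := hab θ (x.1 (superIndex j (x.2.1 j)))
  rw [ghostGap, abs_le]
  constructor <;> linarith [h1.1, h1.2, h2.1, h2.2]

/-- The discarded member of a pair never enters the training data, so it acts as a fresh test point.
-/
lemma dataset_update (s : Fin (N + N) → Z) (u : Fin N → Bool) (j : Fin N) (z : Z) :
    dataset (Function.update s (superIndex j (!(u j))) z) u = dataset s u := by
  ext1 i
  refine Function.update_of_ne (fun h => ?_) _ _
  have hi := i.isLt
  have hj := j.isLt
  have h' := congrArg Fin.val h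
  unfold superIndex at h'
  have hij : i = j := by
    ext
    cases hui : u i <;> cases huj : u j <;> simp [hui, huj] at h' <;> omega
  subst hij
  cases hui : u i <;> simp [hui] at h' <;> omega

/-- The mean gap of the pair `j` at the output, averaged over the noise. -/
noncomputable def meanGap (loss : Param d → Z → ℝ) (η σ : Fin T → ℝ) (ν : Measure (Param d))
    (j : Fin N) (x : Config Z N T) : ℝ :=
  ∫ n, ghostGap loss j x (iterates loss η σ x n (Fin.last T)) ∂(noiseLaw ν T)

lemma abs_meanGap_le {a b : ℝ} (hab : ∀ θ z, loss θ z ∈ Set.Icc a b) (η σ : Fin T → ℝ)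
    (ν : Measure (Param d)) [IsProbabilityMeasure ν] (j : Fin N) (x : Config Z N T) :
    |meanGap loss η σ ν j x| ≤ b - a := by
  have := norm_integral_le_of_norm_le_const (μ := noiseLaw ν T) (C := b - a)
    (f := fun n => ghostGap loss j x (iterates loss η σ x n (Fin.last T)))
    (ae_of_all _ fun n => abs_ghostGap_le hab j x _)
  simpa using! this

variable [MeasurableSpace Z]

/-- The law of super-sample, selection and batches. -/
noncomputable def configLaw (P : Measure Z) (ρ : Measure (Fin T → Finset (Fin N))) :
    Measure (Config Z N T) :=
  (Measure.pi fun _ : Fin (N + N) => P).prod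
    ((Measure.pi fun _ : Fin N => uniformOn (Set.univ : Set Bool)).prod ρ)

instance (P : Measure Z) [IsProbabilityMeasure P] (ρ : Measure (Fin T → Finset (Fin N)))
    [IsProbabilityMeasure ρ] : IsProbabilityMeasure (configLaw P ρ) := by
  unfold configLaw; infer_instance

lemma measurePreserving_configFlip (P : Measure Z) [IsProbabilityMeasure P]
    (ρ : Measure (Fin T → Finset (Fin N))) [IsProbabilityMeasure ρ] (j : Fin N) :
    MeasurePreserving (flip j : Config Z N T → Config Z N T) (configLaw P ρ) (configLaw P ρ) :=
  (MeasurePreserving.id _).prod ((measurePreserving_flip j).prod (MeasurePreserving.id _))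

/-- The accumulated gradient incoherence of the pair `j`, averaged over the noise. -/
noncomputable def accumulated (loss : Param d → Z → ℝ) (η σ : Fin T → ℝ) (ν : Measure (Param d))
    (j : Fin N) (est : (t : Fin T) → (Fin (t.val + 1) → Param d) →
      (Fin (N + N) → Z) → ({i : Fin N // i ≠ j} → Bool) → (Fin T → Finset (Fin N)) → ℝ)
    (x : Config Z N T) : ℝ≥0∞ :=
  ∑ t ∈ stepsWith x.2.2 j, ∫⁻ n, ENNReal.ofReal
    (summand loss η σ x.1 x.2.1 x.2.2 j t (pastIterates (iterates loss η σ x n) t (Fin.last t.val))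
      (est t (pastIterates (iterates loss η σ x n) t) x.1 (fun i => x.2.1 i) x.2.2))
    ∂(noiseLaw ν T)

variable {j : Fin N} {est : (t : Fin T) → (Fin (t.val + 1) → Param d) →
      (Fin (N + N) → Z) → ({i : Fin N // i ≠ j} → Bool) → (Fin T → Finset (Fin N)) → ℝ}

lemma measurable_accumulated (hloss : Measurable (Function.uncurry loss))
    (hdiff : ∀ z, Differentiable ℝ fun θ => loss θ z) (η σ : Fin T → ℝ)
    (ν : Measure (Param d)) [IsProbabilityMeasure ν]
    (hest : ∀ t, Measurable fun x : (Fin (t.val + 1) → Param d) ×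
      (Fin (N + N) → Z) × ({i : Fin N // i ≠ j} → Bool) × (Fin T → Finset (Fin N)) =>
        est t x.1 x.2.1 x.2.2.1 x.2.2.2) :
    Measurable (accumulated loss η σ ν j est) := by
  refine measurable_from_prod_countable_left fun y => ?_
  refine Finset.measurable_fun_sum (stepsWith y.2 j) fun t _ => ?_
  refine Measurable.lintegral_prod_right' (ν := noiseLaw ν T) (f := fun q :
    (Fin (N + N) → Z) × Param d × (Fin T → Param d) => ENNReal.ofReal
    (summand loss η σ q.1 y.1 y.2 j t
      (pastIterates (iterates loss η σ (q.1, y) q.2) t (Fin.last t.val))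
      (est t (pastIterates (iterates loss η σ (q.1, y) q.2) t) q.1 (fun i => y.1 i) y.2))) ?_
  have hpair : Measurable fun q : (Fin (N + N) → Z) × Param d × (Fin T → Param d) =>
      (((q.1, y) : Config Z N T), q.2) :=
    (measurable_fst.prodMk measurable_const).prodMk measurable_snd
  have hpast : Measurable fun q : (Fin (N + N) → Z) × Param d × (Fin T → Param d) =>
      pastIterates (iterates loss η σ (q.1, y) q.2) t :=
    (measurable_initialPart t.isLt.le).comp ((measurable_iterates hloss hdiff η σ).comp hpair)
  have hlast : Measurable fun q : (Fin (N + N) → Z) × Param d × (Fin T → Param d) =>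
      pastIterates (iterates loss η σ (q.1, y) q.2) t (Fin.last t.val) :=
    (measurable_pi_apply (X := fun _ => Param d) (Fin.last t.val)).comp hpast
  have hp := (hest t).comp (hpast.prodMk (measurable_fst.prodMk
    (measurable_const (a := ((fun i : {i : Fin N // i ≠ j} => y.1 i), y.2)))))
  have := (measurable_summand hloss hdiff η σ y.1 y.2 j t).comp
    (measurable_fst.prodMk (hlast.prodMk hp))
  exact this.ennreal_ofReal

lemma measurable_ghostGap (hloss : Measurable (Function.uncurry loss)) (j : Fin N) :
    Measurable fun q : Config Z N T × Param d => ghostGap loss j q.1 q.2 := by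
  refine measurable_of_discrete fun y => ?_
  have h : ∀ i : Fin (N + N), Measurable fun p : (Fin (N + N) → Z) × Param d => loss p.2 (p.1 i) :=
    fun i => hloss.comp (measurable_snd.prodMk ((measurable_pi_apply i).comp measurable_fst))
  exact (h (superIndex j (!(y.1 j)))).sub (h (superIndex j (y.1 j)))

lemma measurable_ghostGap_iterates (hloss : Measurable (Function.uncurry loss))
    (hdiff : ∀ z, Differentiable ℝ fun θ => loss θ z) (η σ : Fin T → ℝ) (j : Fin N) :
    Measurable fun q : Config Z N T × Param d × (Fin T → Param d) =>
      ghostGap loss j q.1 (iterates loss η σ q.1 q.2 (Fin.last T)) := by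
  have hW : Measurable fun q : Config Z N T × Param d × (Fin T → Param d) =>
      iterates loss η σ q.1 q.2 (Fin.last T) :=
    (measurable_pi_apply _).comp (measurable_iterates hloss hdiff η σ)
  have := (measurable_ghostGap (T := T) hloss j).comp (measurable_fst.prodMk hW)
  exact this

lemma measurable_meanGap (hloss : Measurable (Function.uncurry loss))
    (hdiff : ∀ z, Differentiable ℝ fun θ => loss θ z) (η σ : Fin T → ℝ)
    (ν : Measure (Param d)) [IsProbabilityMeasure ν] (j : Fin N) :
    Measurable (meanGap loss η σ ν j : Config Z N T → ℝ) :=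
  ((measurable_ghostGap_iterates hloss hdiff η σ j).stronglyMeasurable.integral_prod_right'
    (ν := noiseLaw ν T)).measurable

/-- The measures `κ t` are left abstract because two representations are needed: `trajLaw` in the
entropy bound and `condDistrib` in the final statement. -/
lemma sum_lintegral_eq_accumulated (hloss : Measurable (Function.uncurry loss))
    (hdiff : ∀ z, Differentiable ℝ fun θ => loss θ z) (η σ : Fin T → ℝ)
    (ν : Measure (Param d)) [IsProbabilityMeasure ν]
    (hest : ∀ t, Measurable fun x : (Fin (t.val + 1) → Param d) ×
      (Fin (N + N) → Z) × ({i : Fin N // i ≠ j} → Bool) × (Fin T → Finset (Fin N)) =>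
        est t x.1 x.2.1 x.2.2.1 x.2.2.2) (x : Config Z N T)
    {κ : (t : Fin T) → Measure (Fin (t.val + 1) → Param d)}
    (hκ : ∀ t, κ t = (noiseLaw ν T).map fun n => pastIterates (iterates loss η σ x n) t) :
    ∑ t ∈ stepsWith x.2.2 j, ∫⁻ w, ENNReal.ofReal
      (summand loss η σ x.1 x.2.1 x.2.2 j t (w (Fin.last t.val))
        (est t w x.1 (fun i => x.2.1 i) x.2.2)) ∂(κ t) = accumulated loss η σ ν j est x := by
  refine Finset.sum_congr rfl fun t _ => ?_
  have hp : Measurable fun w => est t w x.1 (fun i => x.2.1 i) x.2.2 := by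
    have h := (hest t).comp (measurable_prodMk_right
      (y := (x.1, (fun i : {i : Fin N // i ≠ j} => x.2.1 i), x.2.2)))
    exact h
  have hs : Measurable fun w : Fin (t.val + 1) → Param d =>
      summand loss η σ x.1 x.2.1 x.2.2 j t (w (Fin.last t.val))
        (est t w x.1 (fun i => x.2.1 i) x.2.2) := by
    have h : Measurable fun w : Fin (t.val + 1) → Param d =>
        (x.1, w (Fin.last t.val), est t w x.1 (fun i => x.2.1 i) x.2.2) :=
      measurable_const.prodMk ((measurable_pi_apply _).prodMk hp)
    have h' := (measurable_summand hloss hdiff η σ x.2.1 x.2.2 j t).comp h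
    exact h'
  have hpast : Measurable fun n => pastIterates (iterates loss η σ x n) t := by
    have h := (measurable_initialPart t.isLt.le).comp
      ((measurable_iterates hloss hdiff η σ).comp (measurable_prodMk_left (x := x)))
    exact h
  rw [hκ, lintegral_map hs.ennreal_ofReal hpast]

/-- The two selections of the sample `j` have a common reference value for the mean gap. -/
lemma meanGap_sub_le (hloss : Measurable (Function.uncurry loss))
    (hdiff : ∀ z, Differentiable ℝ fun θ => loss θ z) {a b : ℝ}
    (hab : ∀ θ z, loss θ z ∈ Set.Icc a b) (η : Fin T → ℝ) {σ : Fin T → ℝ} (hσ : ∀ t, 0 < σ t)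
    (ν : Measure (Param d)) [IsProbabilityMeasure ν]
    (hest : ∀ t, Measurable fun x : (Fin (t.val + 1) → Param d) ×
      (Fin (N + N) → Z) × ({i : Fin N // i ≠ j} → Bool) × (Fin T → Finset (Fin N)) =>
        est t x.1 x.2.1 x.2.2.1 x.2.2.2) (x : Config Z N T) :
    ENNReal.ofReal |meanGap loss η σ ν j x - ∫ w, ghostGap loss j x (w (Fin.last T))
        ∂(trajLaw ν (noiseLevel σ) (stepMean η (priorGradient loss x.1 x.2.1 x.2.2 j
          fun t w => est t w x.1 (fun i => x.2.1 i) x.2.2)) T)| ≤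
      ENNReal.ofReal (√2 * (b - a)) * accumulated loss η σ ν j est x ^ (1 / 2 : ℝ) := by
  have hp : ∀ t, Measurable fun w => est t w x.1 (fun i => x.2.1 i) x.2.2 := fun t => by
    have := (hest t).comp (measurable_prodMk_right
      (y := (x.1, (fun i : {i : Fin N // i ≠ j} => x.2.1 i), x.2.2)))
    exact this
  have hf : Measurable (ghostGap loss j x) := (measurable_ghostGap hloss j).comp
    measurable_prodMk_left
  have hW : ∀ {n : ℕ} (h : n ≤ T), Measurable fun p : Param d × (Fin T → Param d) =>
      initialPart h (sgld loss η σ (dataset x.1 x.2.1) x.2.2 p.1 p.2) := fun h =>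
    (measurable_initialPart h).comp
      ((measurable_sgld hloss hdiff η σ x.2.2).comp measurable_prodMk_left)
  have key := abs_integral_sub_prior_le ν hloss hdiff η hσ x.1 x.2.1 x.2.2 j hp hf
    (abs_ghostGap_le hab j x)
  have hgap : ∫ w, ghostGap loss j x (w (Fin.last T)) ∂(trajLaw ν (noiseLevel σ)
      (stepMean η (batchGradient loss (dataset x.1 x.2.1) x.2.2)) T) =
      meanGap loss η σ ν j x := by
    have hfm : Measurable fun w : Fin (T + 1) → Param d => ghostGap loss j x (w (Fin.last T)) :=
      hf.comp (measurable_pi_apply _)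
    rw [← map_initialPart_sgld ν hloss hdiff η σ (dataset x.1 x.2.1) x.2.2 le_rfl,
      integral_map (hW le_rfl).aemeasurable hfm.aestronglyMeasurable]
    rfl
  have hacc := sum_lintegral_eq_accumulated hloss hdiff η σ ν hest x
    (κ := fun t => trajLaw ν (noiseLevel σ)
      (stepMean η (batchGradient loss (dataset x.1 x.2.1) x.2.2)) t.val)
    fun t => (map_initialPart_sgld ν hloss hdiff η σ (dataset x.1 x.2.1) x.2.2 t.isLt.le).symm
  rw [hgap, hacc] at key
  exact key

/-- The estimate and the reference drift use only selections other than that of `j`, so `x` and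
`flip j x` have the same reference law, while the gap changes sign. The reference values therefore
cancel in the sum. -/
lemma meanGap_add_flip_le (hloss : Measurable (Function.uncurry loss))
    (hdiff : ∀ z, Differentiable ℝ fun θ => loss θ z) {a b : ℝ}
    (hab : ∀ θ z, loss θ z ∈ Set.Icc a b) (η : Fin T → ℝ) {σ : Fin T → ℝ} (hσ : ∀ t, 0 < σ t)
    (ν : Measure (Param d)) [IsProbabilityMeasure ν]
    (hest : ∀ t, Measurable fun x : (Fin (t.val + 1) → Param d) ×
      (Fin (N + N) → Z) × ({i : Fin N // i ≠ j} → Bool) × (Fin T → Finset (Fin N)) =>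
        est t x.1 x.2.1 x.2.2.1 x.2.2.2) (x : Config Z N T) :
    ENNReal.ofReal (meanGap loss η σ ν j x + meanGap loss η σ ν j (flip j x)) ≤
      ENNReal.ofReal (√2 * (b - a)) * accumulated loss η σ ν j est x ^ (1 / 2 : ℝ) +
      ENNReal.ofReal (√2 * (b - a)) * accumulated loss η σ ν j est (flip j x) ^ (1 / 2 : ℝ) := by
  have h1 := meanGap_sub_le hloss hdiff hab η hσ ν hest x
  have h2 := meanGap_sub_le hloss hdiff hab η hσ ν hest (flip j x)
  have hprior : priorGradient loss (flip j x).1 (flip j x).2.1 (flip j x).2.2 j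
      (fun t w => est t w (flip j x).1 (fun i => (flip j x).2.1 i) (flip j x).2.2) =
      priorGradient loss x.1 x.2.1 x.2.2 j
        (fun t w => est t w x.1 (fun i => x.2.1 i) x.2.2) := by
    have he : (fun i : {i : Fin N // i ≠ j} => (flip j x).2.1 i) = fun i => x.2.1 i.1 := by
      ext1 i
      exact Function.update_of_ne i.2 _ _
    rw [he]
    exact priorGradient_congr (fun i hi => Function.update_of_ne hi _ _) _
  rw [hprior] at h2
  simp only [ghostGap_flip, integral_neg] at h2
  refine le_trans ?_ (add_le_add h1 h2)
  rw [← ENNReal.ofReal_add (abs_nonneg _) (abs_nonneg _)]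
  refine ENNReal.ofReal_le_ofReal (le_trans (le_of_eq ?_)
    (add_le_add (le_abs_self _) (le_abs_self _)))
  ring

lemma ofReal_integral_meanGap_le (P : Measure Z) [IsProbabilityMeasure P]
    (ρ : Measure (Fin T → Finset (Fin N))) [IsProbabilityMeasure ρ]
    (hloss : Measurable (Function.uncurry loss))
    (hdiff : ∀ z, Differentiable ℝ fun θ => loss θ z) {a b : ℝ}
    (hab : ∀ θ z, loss θ z ∈ Set.Icc a b) (η : Fin T → ℝ) {σ : Fin T → ℝ} (hσ : ∀ t, 0 < σ t)
    (ν : Measure (Param d)) [IsProbabilityMeasure ν]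
    (hest : ∀ t, Measurable fun x : (Fin (t.val + 1) → Param d) ×
      (Fin (N + N) → Z) × ({i : Fin N // i ≠ j} → Bool) × (Fin T → Finset (Fin N)) =>
        est t x.1 x.2.1 x.2.2.1 x.2.2.2) :
    ENNReal.ofReal (∫ x, meanGap loss η σ ν j x ∂(configLaw P ρ)) ≤
      ENNReal.ofReal (√2 * (b - a)) *
        ∫⁻ x, accumulated loss η σ ν j est x ^ (1 / 2 : ℝ) ∂(configLaw P ρ) := by
  have hflip := measurePreserving_configFlip (T := T) P ρ j
  have hm : Measurable (meanGap loss η σ ν j : Config Z N T → ℝ) :=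
    measurable_meanGap hloss hdiff η σ ν j
  have hi : Integrable (meanGap loss η σ ν j) (configLaw P ρ) :=
    integrable_of_abs_le hm (abs_meanGap_le hab η σ ν j)
  have hi' : Integrable (fun x => meanGap loss η σ ν j (flip j x)) (configLaw P ρ) :=
    integrable_of_abs_le (hm.comp hflip.measurable) fun x => abs_meanGap_le hab η σ ν j _
  have hacc : Measurable fun x => accumulated loss η σ ν j est x ^ (1 / 2 : ℝ) :=
    (measurable_accumulated hloss hdiff η σ ν hest).pow_const _
  have hsum : ∫ x, (meanGap loss η σ ν j x + meanGap loss η σ ν j (flip j x)) ∂(configLaw P ρ) =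
      2 * ∫ x, meanGap loss η σ ν j x ∂(configLaw P ρ) := by
    have : ∫ x, meanGap loss η σ ν j (flip j x) ∂(configLaw P ρ) =
        ∫ x, meanGap loss η σ ν j x ∂(configLaw P ρ) := by
      conv_rhs => rw [← hflip.map_eq]
      rw [integral_map hflip.measurable.aemeasurable hm.aestronglyMeasurable]
    rw [integral_add hi hi', this, two_mul]
  have hle := (ofReal_integral_le_lintegral_ofReal (hi.add hi')).trans
    (lintegral_mono (meanGap_add_flip_le hloss hdiff hab η hσ ν hest))
  simp only [Pi.add_apply] at hle
  have hacc' : Measurable fun x => accumulated loss η σ ν j est (flip j x) ^ (1 / 2 : ℝ) :=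
    hacc.comp hflip.measurable
  rw [hsum, lintegral_add_left (hacc.const_mul _), lintegral_const_mul _ hacc,
    lintegral_const_mul _ hacc', hflip.lintegral_comp hacc, ← two_mul (_ * _),
    ENNReal.ofReal_mul zero_le_two, ENNReal.ofReal_ofNat] at hle
  -- Invariance under the reversal has doubled both sides.
  exact (ENNReal.mul_le_mul_iff_right two_ne_zero ENNReal.ofNat_ne_top).1 hle

end MeanGap

/-! ### Order of integration. -/

section Law

variable {α β γ : Type*} [MeasurableSpace α] [MeasurableSpace β] [MeasurableSpace γ]

/-- The first factor, later the super-sample, goes innermost, so that the index of the discarded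
sample is constant while it is integrated. -/
lemma integral_prod_prod_symm {μ : Measure α} {ν : Measure β} {τ : Measure γ}
    [IsProbabilityMeasure μ] [IsProbabilityMeasure ν] [IsProbabilityMeasure τ]
    {f : (α × β) × γ → ℝ} (hf : Measurable f) {C : ℝ} (hC : ∀ q, |f q| ≤ C) :
    ∫ q, f q ∂((μ.prod ν).prod τ) = ∫ n, ∫ y, ∫ s, f ((s, y), n) ∂μ ∂ν ∂τ := by
  rw [integral_prod_symm _ (integrable_of_abs_le hf hC)]
  refine integral_congr_ae (ae_of_all _ fun n => ?_)
  have hfn : Measurable fun p : α × β => f (p, n) := hf.comp measurable_prodMk_right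
  exact integral_prod_symm _ (integrable_of_abs_le hfn fun p => hC _)

end Law

/-! ### Generalization error as a mean gap, and the conditional law of the past. -/

section GeneralizationError

variable {Z : Type*} {d N T : ℕ} {loss : Param d → Z → ℝ}

/-- The batches before step `t`, continued by empty batches. -/
def extendBatches (t : Fin T) (v : Fin t.val → Finset (Fin N)) : Fin T → Finset (Fin N) :=
  fun i => if h : i.val < t.val then v ⟨i.val, h⟩ else ∅

/-- By causality the continuation by empty batches is immaterial; it exhibits the past as a function
of past batches, data, selection and noise. -/
lemma pastIterates_iterates_extend (η σ : Fin T → ℝ) (x : Config Z N T)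
    (n : Param d × (Fin T → Param d)) (t : Fin T) :
    pastIterates (iterates loss η σ x n) t =
      pastIterates (iterates loss η σ
        (x.1, x.2.1, extendBatches t (pastBatches x.2.2 t)) n) t := by
  ext1 k
  refine sgld_congr (v := x.2.2) (v' := extendBatches t (pastBatches x.2.2 t)) (ε := n.2)
    (ε' := n.2) η σ (dataset x.1 x.2.1) n.1 (k.castLE (Nat.succ_le_succ t.isLt.le))
    (fun i hi => ?_) fun _ _ => rfl
  have hik : i.val < k.val := hi
  have : i.val < t.val := by omega
  simp only [extendBatches, this, dif_pos, pastBatches]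
  rfl

variable [MeasurableSpace Z]

lemma integral_gen_eq (P : Measure Z) [IsProbabilityMeasure P]
    (ρ : Measure (Fin T → Finset (Fin N))) [IsProbabilityMeasure ρ]
    (hloss : Measurable (Function.uncurry loss))
    (hdiff : ∀ z, Differentiable ℝ fun θ => loss θ z) {a b : ℝ}
    (hab : ∀ θ z, loss θ z ∈ Set.Icc a b) (η σ : Fin T → ℝ)
    (ν : Measure (Param d)) [IsProbabilityMeasure ν] (hN : N ≠ 0) :
    ∫ q, gen P loss (iterates loss η σ q.1 q.2 (Fin.last T)) (dataset q.1.1 q.1.2.1)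
        ∂((configLaw P ρ).prod (noiseLaw ν T)) =
      ∑ j : Fin N, (N : ℝ)⁻¹ * ∫ x, meanGap loss η σ ν j x ∂(configLaw P ρ) := by
  set κ := (configLaw (N := N) P ρ).prod (noiseLaw ν T) with hκ
  have hN' : (N : ℝ) ≠ 0 := Nat.cast_ne_zero.2 hN
  have hbd : ∀ θ z, |loss θ z| ≤ max |a| |b| := fun θ z =>
    abs_le_max_abs_abs (hab θ z).1 (hab θ z).2
  have hW : Measurable fun q : Config Z N T × Param d × (Fin T → Param d) =>
      iterates loss η σ q.1 q.2 (Fin.last T) :=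
    (measurable_pi_apply _).comp (measurable_iterates hloss hdiff η σ)
  have hpop : Measurable fun θ : Param d => ∫ z, loss θ z ∂P :=
    (hloss.stronglyMeasurable.integral_prod_right' (ν := P)).measurable
  have hpopbd : ∀ θ : Param d, |∫ z, loss θ z ∂P| ≤ max |a| |b| := fun θ => by
    have := norm_integral_le_of_norm_le_const (μ := P) (f := fun z => loss θ z)
      (C := max |a| |b|) (ae_of_all _ fun z => hbd θ z)
    simpa using! this
  have hA : Measurable fun q : Config Z N T × Param d × (Fin T → Param d) =>
      ∫ z, loss (iterates loss η σ q.1 q.2 (Fin.last T)) z ∂P := hpop.comp hW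
  have hsel : ∀ c : (Fin N → Bool) → Fin (N + N),
      Measurable fun q : Config Z N T × Param d × (Fin T → Param d) => q.1.1 (c q.1.2.1) :=
    fun c => measurable_of_discrete fun y =>
      (measurable_pi_apply (X := fun _ => Z) (c y.1)).comp measurable_fst
  have hB : ∀ c : (Fin N → Bool) → Fin (N + N),
      Measurable fun q : Config Z N T × Param d × (Fin T → Param d) =>
        loss (iterates loss η σ q.1 q.2 (Fin.last T)) (q.1.1 (c q.1.2.1)) :=
    fun c => hloss.comp (hW.prodMk (hsel c))
  -- With noise, selection and batches fixed, the output ignores the discarded sample, so averaging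
  -- over that sample gives the population risk.
  have hghost : ∀ j : Fin N,
      ∫ q, ∫ z, loss (iterates loss η σ q.1 q.2 (Fin.last T)) z ∂P ∂κ =
      ∫ q, loss (iterates loss η σ q.1 q.2 (Fin.last T))
        (q.1.1 (superIndex j (!(q.1.2.1 j)))) ∂κ := by
    intro j
    rw [hκ, configLaw, integral_prod_prod_symm hA fun q => hpopbd _,
      integral_prod_prod_symm (hB fun u => superIndex j (!(u j))) fun q => hbd _ _]
    refine integral_congr_ae (ae_of_all _ fun n => integral_congr_ae (ae_of_all _ fun y => ?_))
    refine integral_pi_coordinate P (superIndex j (!(y.1 j)))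
      (g := fun s => iterates loss η σ (s, y) n (Fin.last T)) ?_ ?_ hloss (fun θ z => hbd θ z)
    · exact hW.comp ((measurable_id.prodMk measurable_const).prodMk measurable_const)
    · intro s z
      simp only [iterates, dataset_update]
  have hBi : ∀ c : (Fin N → Bool) → Fin (N + N), Integrable (fun q =>
      loss (iterates loss η σ q.1 q.2 (Fin.last T)) (q.1.1 (c q.1.2.1))) κ :=
    fun c => integrable_of_abs_le (hB c) fun q => hbd _ _
  have hAi : Integrable (fun q : Config Z N T × Param d × (Fin T → Param d) =>
      ∫ z, loss (iterates loss η σ q.1 q.2 (Fin.last T)) z ∂P) κ :=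
    integrable_of_abs_le hA fun q => hpopbd _
  have hgap : ∀ j : Fin N, ∫ x, meanGap loss η σ ν j x ∂(configLaw P ρ) =
      ∫ q, (∫ z, loss (iterates loss η σ q.1 q.2 (Fin.last T)) z ∂P
        - loss (iterates loss η σ q.1 q.2 (Fin.last T))
          (q.1.1 (superIndex j (q.1.2.1 j)))) ∂κ := by
    intro j
    rw [integral_sub hAi (hBi fun u => superIndex j (u j)), hghost j,
      ← integral_sub (hBi fun u => superIndex j (!(u j))) (hBi fun u => superIndex j (u j))]
    exact (integral_prod _ (integrable_of_abs_le (measurable_ghostGap_iterates hloss hdiff η σ j)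
      fun q => abs_ghostGap_le hab j _ _)).symm
  simp only [hgap, ← integral_const_mul]
  have hgi : ∀ j : Fin N, Integrable (fun q => (N : ℝ)⁻¹ *
      (∫ z, loss (iterates loss η σ q.1 q.2 (Fin.last T)) z ∂P
        - loss (iterates loss η σ q.1 q.2 (Fin.last T))
          (q.1.1 (superIndex j (q.1.2.1 j))))) κ :=
    fun j => (hAi.sub (hBi fun u => superIndex j (u j))).const_mul _
  rw [← integral_finsetSum _ fun j _ => hgi j]
  refine integral_congr_ae (ae_of_all _ fun q => ?_)
  simp only [gen, batchRisk, dataset]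
  rw [← Finset.mul_sum, Finset.sum_sub_distrib]
  simp only [Finset.sum_const, Finset.card_univ, Fintype.card_fin, nsmul_eq_mul, one_div]
  rw [mul_sub, inv_mul_cancel_left₀ hN']

lemma measurable_gen_iterates (P : Measure Z) [IsProbabilityMeasure P]
    (hloss : Measurable (Function.uncurry loss))
    (hdiff : ∀ z, Differentiable ℝ fun θ => loss θ z) (η σ : Fin T → ℝ) :
    Measurable fun q : Config Z N T × Param d × (Fin T → Param d) =>
      gen P loss (iterates loss η σ q.1 q.2 (Fin.last T)) (dataset q.1.1 q.1.2.1) := by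
  have hW : Measurable fun q : Config Z N T × Param d × (Fin T → Param d) =>
      iterates loss η σ q.1 q.2 (Fin.last T) :=
    (measurable_pi_apply _).comp (measurable_iterates hloss hdiff η σ)
  have hpop : Measurable fun θ : Param d => ∫ z, loss θ z ∂P :=
    (hloss.stronglyMeasurable.integral_prod_right' (ν := P)).measurable
  have hsel : ∀ i, Measurable fun q : Config Z N T × Param d × (Fin T → Param d) =>
      dataset q.1.1 q.1.2.1 i := fun i => measurable_of_discrete fun y =>
    (measurable_pi_apply (X := fun _ => Z) (superIndex i (y.1 i))).comp measurable_fst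
  have hrisk : Measurable fun q : Config Z N T × Param d × (Fin T → Param d) =>
      ∑ i, loss (iterates loss η σ q.1 q.2 (Fin.last T)) (dataset q.1.1 q.1.2.1 i) :=
    Finset.measurable_fun_sum _ fun i _ => hloss.comp (hW.prodMk (hsel i))
  exact (hpop.comp hW).sub (hrisk.const_mul _)

/-- The noise is independent of the configuration, so conditioning freezes the configuration and
averages over the noise. Future batches on the right do no harm, since the past does not depend on
them. -/
lemma condDistrib_pastIterates {Ω : Type*} [MeasurableSpace Ω] {μ : Measure Ω}
    [IsProbabilityMeasure μ] (hloss : Measurable (Function.uncurry loss))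
    (hdiff : ∀ z, Differentiable ℝ fun θ => loss θ z) (η σ : Fin T → ℝ)
    {π : Measure (Config Z N T)} [IsProbabilityMeasure π]
    {ν : Measure (Param d)} [IsProbabilityMeasure ν]
    {X : Ω → Config Z N T} {Y : Ω → Param d × (Fin T → Param d)}
    (hXY : HasLaw (fun ω => (X ω, Y ω)) (π.prod (noiseLaw ν T)) μ) (t : Fin T) :
    ∀ᵐ ω ∂μ, condDistrib (fun ω' => pastIterates (iterates loss η σ (X ω') (Y ω')) t)
        (fun ω' => ((X ω').2.1, (X ω').1, pastBatches (X ω').2.2 t)) μ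
        ((X ω).2.1, (X ω).1, pastBatches (X ω).2.2 t) =
      (noiseLaw ν T).map fun n => pastIterates (iterates loss η σ (X ω) n) t := by
  set g : Config Z N T → (Fin N → Bool) × (Fin (N + N) → Z) × (Fin t.val → Finset (Fin N)) :=
    fun x => (x.2.1, x.1, pastBatches x.2.2 t)
  have hg : Measurable g :=
    (measurable_fst.comp measurable_snd).prodMk (measurable_fst.prodMk
      ((measurable_of_countable (fun v : Fin T → Finset (Fin N) => pastBatches v t)).comp
        (measurable_snd.comp measurable_snd)))
  have hX : AEMeasurable X μ := measurable_fst.comp_aemeasurable hXY.aemeasurable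
  have hY : AEMeasurable Y μ := measurable_snd.comp_aemeasurable hXY.aemeasurable
  have hXlaw : μ.map X = π := by
    have h := congrArg (Measure.map Prod.fst) hXY.map_eq
    rw [AEMeasurable.map_map_of_aemeasurable measurable_fst.aemeasurable hXY.aemeasurable,
      (measurePreserving_fst (μ := π)).map_eq] at h
    exact h
  have hgX : AEMeasurable (fun ω => g (X ω)) μ := hg.comp_aemeasurable hX
  have hglaw : μ.map (fun ω => g (X ω)) = π.map g := by
    rw [← hXlaw, AEMeasurable.map_map_of_aemeasurable hg.aemeasurable hX]
    rfl
  have hlaw : μ.map (fun ω => (g (X ω), Y ω)) = (μ.map fun ω => g (X ω)).prod (noiseLaw ν T) := by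
    have h := Measure.map_prod_map π (noiseLaw ν T) hg measurable_id
    rw [Measure.map_id] at h
    rw [hglaw, h, ← hXY.map_eq, AEMeasurable.map_map_of_aemeasurable
      (hg.prodMap measurable_id).aemeasurable hXY.aemeasurable]
    rfl
  set F : ((Fin N → Bool) × (Fin (N + N) → Z) × (Fin t.val → Finset (Fin N))) ×
      (Param d × (Fin T → Param d)) → (Fin (t.val + 1) → Param d) := fun q =>
    pastIterates (iterates loss η σ (q.1.2.1, q.1.1, extendBatches t q.1.2.2) q.2) t with hF
  have hFm : Measurable F := by
    have h1 : Measurable fun q : ((Fin N → Bool) × (Fin (N + N) → Z) ×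
        (Fin t.val → Finset (Fin N))) × (Param d × (Fin T → Param d)) =>
        (((q.1.2.1, q.1.1, extendBatches t q.1.2.2) : Config Z N T), q.2) :=
      ((measurable_fst.comp (measurable_snd.comp measurable_fst)).prodMk
        ((measurable_fst.comp measurable_fst).prodMk
          ((measurable_of_countable (extendBatches (N := N) t)).comp
            (measurable_snd.comp (measurable_snd.comp measurable_fst))))).prodMk measurable_snd
    exact (measurable_initialPart t.isLt.le).comp ((measurable_iterates hloss hdiff η σ).comp h1)
  have key := ae_of_ae_map hgX (condDistrib_of_prod_law hgX hY hlaw hFm)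
  have hrew : (fun ω' => pastIterates (iterates loss η σ (X ω') (Y ω')) t) =
      fun ω => F (g (X ω), Y ω) := by
    ext1 ω
    exact pastIterates_iterates_extend η σ (X ω) (Y ω) t
  rw [hrew]
  filter_upwards [key] with ω hω
  rw [hω]
  congr 1
  ext1 n
  exact (pastIterates_iterates_extend η σ (X ω) n t).symm

lemma measurePreserving_configAssoc (P : Measure Z) [IsProbabilityMeasure P]
    (ρ : Measure (Fin T → Finset (Fin N))) [IsProbabilityMeasure ρ]
    (ν : Measure (Param d)) [IsProbabilityMeasure ν] :
    MeasurePreserving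
      (fun q : (Fin (N + N) → Z) × (Fin N → Bool) × (Fin T → Finset (Fin N)) ×
        Param d × (Fin T → Param d) => (((q.1, q.2.1, q.2.2.1) : Config Z N T), q.2.2.2))
      ((Measure.pi fun _ : Fin (N + N) => P).prod
        ((Measure.pi fun _ : Fin N => uniformOn (Set.univ : Set Bool)).prod
          (ρ.prod (noiseLaw ν T))))
      ((configLaw P ρ).prod (noiseLaw ν T)) := by
  have h1 := measurePreserving_prodAssoc (Measure.pi fun _ : Fin (N + N) => P)
    ((Measure.pi fun _ : Fin N => uniformOn (Set.univ : Set Bool)).prod ρ) (noiseLaw ν T)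
  have h2 := (MeasurePreserving.id (Measure.pi fun _ : Fin (N + N) => P)).prod
    (measurePreserving_prodAssoc (Measure.pi fun _ : Fin N => uniformOn (Set.univ : Set Bool))
      ρ (noiseLaw ν T))
  have h := h2.comp h1
  have hm : Measurable fun q : (Fin (N + N) → Z) × (Fin N → Bool) × (Fin T → Finset (Fin N)) ×
      Param d × (Fin T → Param d) => (((q.1, q.2.1, q.2.2.1) : Config Z N T), q.2.2.2) :=
    (measurable_fst.prodMk ((measurable_fst.comp measurable_snd).prodMk
      (measurable_fst.comp (measurable_snd.comp measurable_snd)))).prodMk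
      (measurable_snd.comp (measurable_snd.comp measurable_snd))
  refine ⟨hm, ?_⟩
  -- The map undoes the reassociation `h`, so the composition is the identity.
  rw [← h.map_eq, Measure.map_map hm h.measurable, configLaw]
  exact Measure.map_id

end GeneralizationError

end SGLDGen

theorem proposition6 {Ω Z : Type*} [MeasurableSpace Ω] [MeasurableSpace Z] {d N T : ℕ}
    (μ : Measure Ω) [IsProbabilityMeasure μ]
    -- the data distribution
    (P : Measure Z) [IsProbabilityMeasure P]
    -- a measurable loss, differentiable in the parameter and bounded in `[a, b]`
    (loss : SGLDGen.Param d → Z → ℝ) (hloss : Measurable (Function.uncurry loss))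
    (hdiff : ∀ z, Differentiable ℝ fun θ => loss θ z)
    (a b : ℝ) (hab : ∀ θ z, loss θ z ∈ Set.Icc a b)
    -- step sizes and noise levels
    (η σ : Fin T → ℝ) (hσ : ∀ t, 0 < σ t)
    -- super-sample, selection variables, batches, initialization, noise
    (S : Ω → Fin (N + N) → Z) (U : Ω → Fin N → Bool) (V : Ω → Fin T → Finset (Fin N))
    (θ₀ : Ω → SGLDGen.Param d) (ε : Ω → Fin T → SGLDGen.Param d)
    -- arbitrary laws of the batch trajectory and of the initialization
    (ρ : Measure (Fin T → Finset (Fin N))) [IsProbabilityMeasure ρ]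
    (ν : Measure (SGLDGen.Param d)) [IsProbabilityMeasure ν]
    -- `S`, `U`, `V`, `θ₀`, `ε` are independent; `S` is i.i.d. from `P`, `U` consists of i.i.d. fair
    -- bits, and `ε` of i.i.d. standard Gaussian vectors
    (hlaw : HasLaw (fun ω => (S ω, U ω, V ω, θ₀ ω, ε ω))
      ((Measure.pi fun _ : Fin (N + N) => P).prod
        ((Measure.pi fun _ : Fin N => uniformOn (Set.univ : Set Bool)).prod
          (ρ.prod (ν.prod
            (Measure.pi fun _ : Fin T => stdGaussian (SGLDGen.Param d)))))) μ)
    -- a uniformly distributed index, independent of super-sample, selection and batches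
    (J : Ω → Fin N) (hJ : HasLaw J (uniformOn (Set.univ : Set (Fin N))) μ)
    (hJ_indep : IndepFun J (fun ω => (S ω, U ω, V ω)) μ)
    -- the iterates
    (W : Ω → Fin (T + 1) → SGLDGen.Param d)
    (hW : ∀ ω, W ω = SGLDGen.sgld loss η σ (SGLDGen.dataset (S ω) (U ω)) (V ω) (θ₀ ω) (ε ω))
    -- an estimate of the probability that `U j = 1` from the past iterates, the super-sample, the
    -- selection variables other than `U j`, and the batches
    (est : (t : Fin T) → (j : Fin N) → (Fin (t.val + 1) → SGLDGen.Param d) →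
      (Fin (N + N) → Z) → ({i : Fin N // i ≠ j} → Bool) → (Fin T → Finset (Fin N)) → ℝ)
    (hest_meas : ∀ t j, Measurable fun x : (Fin (t.val + 1) → SGLDGen.Param d) ×
      (Fin (N + N) → Z) × ({i : Fin N // i ≠ j} → Bool) × (Fin T → Finset (Fin N)) =>
        est t j x.1 x.2.1 x.2.2.1 x.2.2.2)
    (hest : ∀ t j w s u v, est t j w s u v ∈ Set.Icc (0 : ℝ) 1) :
    ENNReal.ofReal
        (∫ ω, SGLDGen.gen P loss (W ω (Fin.last T)) (SGLDGen.dataset (S ω) (U ω)) ∂μ) ≤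
      ENNReal.ofReal (√2 * (b - a)) *
        ∫⁻ ω, (∑ t ∈ SGLDGen.stepsWith (V ω) (J ω),
          ∫⁻ w, ENNReal.ofReal
              (SGLDGen.summand loss η σ (S ω) (U ω) (V ω) (J ω) t (w (Fin.last t.val))
                (est t (J ω) w (S ω) (fun i => U ω i) (V ω)))
            ∂(condDistrib (fun ω' => SGLDGen.pastIterates (W ω') t)
                (fun ω' => (U ω', S ω', SGLDGen.pastBatches (V ω') t)) μ
                (U ω, S ω, SGLDGen.pastBatches (V ω) t))) ^ (1 / 2 : ℝ) ∂μ := by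
  have hN : N ≠ 0 := by
    rintro rfl
    obtain ⟨ω⟩ : Nonempty Ω := nonempty_of_isProbabilityMeasure μ
    exact (J ω).elim0
  have : Nonempty (Fin N) := ⟨⟨0, Nat.pos_of_ne_zero hN⟩⟩
  have hunif : IsProbabilityMeasure (uniformOn (Set.univ : Set (Fin N))) :=
    isProbabilityMeasure_uniformOn Set.finite_univ Set.univ_nonempty
  obtain rfl : W = fun ω => SGLDGen.iterates loss η σ (S ω, U ω, V ω) (θ₀ ω, ε ω) := funext hW
  have hXY : HasLaw (fun ω => (((S ω, U ω, V ω) : SGLDGen.Config Z N T), (θ₀ ω, ε ω)))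
      ((SGLDGen.configLaw P ρ).prod (SGLDGen.noiseLaw ν T)) μ :=
    (SGLDGen.measurePreserving_configAssoc P ρ ν).fun_comp_hasLaw hlaw
  have hXlaw : HasLaw (fun ω => ((S ω, U ω, V ω) : SGLDGen.Config Z N T))
      (SGLDGen.configLaw P ρ) μ :=
    (measurePreserving_fst (μ := SGLDGen.configLaw P ρ)
      (ν := SGLDGen.noiseLaw ν T)).fun_comp_hasLaw hXY
  -- This joint law is all that is needed of `J`: the left-hand side does not involve `J`, and on
  -- the right the noise is averaged out by the conditional laws.
  have hJX : HasLaw (fun ω => (J ω, ((S ω, U ω, V ω) : SGLDGen.Config Z N T)))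
      ((uniformOn (Set.univ : Set (Fin N))).prod (SGLDGen.configLaw P ρ)) μ :=
    ⟨hJ.aemeasurable.prodMk hXlaw.aemeasurable, by
      rw [(indepFun_iff_map_prod_eq_prod_map_map hJ.aemeasurable hXlaw.aemeasurable).1 hJ_indep,
        hJ.map_eq, hXlaw.map_eq]⟩
  obtain ⟨root, hroot⟩ : ∃ root : Fin N × SGLDGen.Config Z N T → ℝ≥0∞, ∀ q, root q =
      SGLDGen.accumulated loss η σ ν q.1 (fun t => est t q.1) q.2 ^ (1 / 2 : ℝ) :=
    ⟨_, fun _ => rfl⟩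
  have hroot_meas : Measurable root := measurable_from_prod_countable_right fun j => by
    simp only [hroot]
    exact (SGLDGen.measurable_accumulated hloss hdiff η σ ν fun t => hest_meas t j).pow_const _
  have hleft : ∫ ω, SGLDGen.gen P loss
      (SGLDGen.iterates loss η σ (S ω, U ω, V ω) (θ₀ ω, ε ω) (Fin.last T))
      (SGLDGen.dataset (S ω) (U ω)) ∂μ =
      ∑ j : Fin N, (N : ℝ)⁻¹ *
        ∫ x, SGLDGen.meanGap loss η σ ν j x ∂(SGLDGen.configLaw P ρ) := by
    rw [← SGLDGen.integral_gen_eq P ρ hloss hdiff hab η σ ν hN, ← hXY.integral_comp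
      (SGLDGen.measurable_gen_iterates P hloss hdiff η σ).aestronglyMeasurable]
    rfl
  have hmain : ENNReal.ofReal (∑ j : Fin N, (N : ℝ)⁻¹ *
      ∫ x, SGLDGen.meanGap loss η σ ν j x ∂(SGLDGen.configLaw P ρ)) ≤
      ENNReal.ofReal (√2 * (b - a)) * ∫⁻ ω, root (J ω, S ω, U ω, V ω) ∂μ := by
    rw [hJX.lintegral_comp hroot_meas.aemeasurable, SGLDGen.lintegral_uniformOn_prod hroot_meas,
      Finset.mul_sum]
    -- Single mean gaps may be negative, so `ENNReal.ofReal` is only subadditive over the pairs.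
    refine (Finset.le_sum_of_subadditive _ ENNReal.ofReal_zero.le
      (fun _ _ => ENNReal.ofReal_add_le) _ _).trans (Finset.sum_le_sum fun j _ => ?_)
    rw [ENNReal.ofReal_mul (by positivity), ENNReal.ofReal_inv_of_pos
      (Nat.cast_pos.2 (Nat.pos_of_ne_zero hN)), ENNReal.ofReal_natCast, mul_left_comm]
    simp only [hroot]
    exact mul_le_mul' le_rfl
      (SGLDGen.ofReal_integral_meanGap_le P ρ hloss hdiff hab η hσ ν fun t => hest_meas t j)
  have hcond := ae_all_iff.2 fun t : Fin T =>
    SGLDGen.condDistrib_pastIterates hloss hdiff η σ hXY t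
  refine (ENNReal.ofReal_le_ofReal hleft.le).trans (hmain.trans ?_)
  refine mul_le_mul' le_rfl (lintegral_mono_ae ?_)
  filter_upwards [hcond] with ω hω
  rw [hroot, ← SGLDGen.sum_lintegral_eq_accumulated hloss hdiff η σ ν
    (fun t => hest_meas t (J ω)) (S ω, U ω, V ω) hω]
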